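/- All graphs are finite and simple. Let $k$ be a nonnegative integer. A graph $H$ is called group $k$-choosable if, under every orientation of $E(H)$, for every Abelian group $A$ of order at least $k$ (possibly infinite), every assignment of a list $L(v)\subseteq A$ with $|L(v)|=k$ to each vertex $v\in V(H)$, and every function $f:E(H)\to A$, there is a map $c:V(H)\to A$ such that $c(v)\in L(v)$ for every $v\in V(H)$ and $c(u)-c(v)\neq f(uv)$ for every edge $uv$ directed from $u$ to $v$. A graph $G$ is called group $k$-edge-choosable if its line graph $\mathcal{L}(G)$ is group $k$-choosable; here the vertices of $\mathcal{L}(G)$ are the edges of $G$, two distinct ones being adjacent if and only if they share an endpoint in $G$. The girth of $G$ is the length of its shortest cycle, or $+\infty$ if $G$ is a forest, and $\Delta(G)$ is the maximum degree of $G$. Theorem. Every planar graph $G$ with girth at least $5$ is group $(\Delta(G)+1)$-edge-choosable. -/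

import Mathlib

universe u w

namespace SimpleGraph

/-- An orientation of the edges of `G`: each edge `uv` becomes exactly one of the arcs
`u → v` and `v → u`. -/
structure EdgeOrientation {V : Type u} (G : SimpleGraph V) where
  /-- `Arc x y` means that the edge `xy` is directed from `x` to `y`. -/
  Arc : V → V → Prop
  adj_iff : ∀ x y, G.Adj x y ↔ Arc x y ∨ Arc y x
  asymm : ∀ x y, Arc x y → ¬ Arc y x

theorem EdgeOrientation.adj {V : Type u} {G : SimpleGraph V} (D : G.EdgeOrientation) {x y : V}
    (h : D.Arc x y) : G.Adj x y :=
  (D.adj_iff x y).2 (Or.inl h)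

/-- `c` is an `(A, f)`-coloring of `G` under the orientation `D`: every edge `xy` directed from
`x` to `y` satisfies `c x - c y ≠ f (xy)`. -/
def IsGroupColoring {V : Type u} {G : SimpleGraph V} (D : G.EdgeOrientation)
    {A : Type w} [AddCommGroup A] (f : G.edgeSet → A) (c : V → A) : Prop :=
  ∀ (x y : V) (h : D.Arc x y), c x - c y ≠ f ⟨s(x, y), G.mem_edgeSet.2 (D.adj h)⟩

/-- `G` is group `k`-choosable: under every orientation of its edges, for every Abelian group `A`
of order at least `k`, every assignment `L` of `k`-element lists of elements of `A` to the vertices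
and every `f : E(G) → A`, there is an `(A, f)`-coloring `c` with `c v ∈ L v` for every `v`. -/
def IsGroupChoosable {V : Type u} (G : SimpleGraph V) (k : ℕ) : Prop :=
  ∀ (D : G.EdgeOrientation) (A : Type w) [AddCommGroup A], (k : ℕ∞) ≤ ENat.card A →
    ∀ L : V → Finset A, (∀ v, (L v).card = k) →
      ∀ f : G.edgeSet → A, ∃ c : V → A, IsGroupColoring D f c ∧ ∀ v, c v ∈ L v

/-- `G` is group `k`-edge-choosable: its line graph is group `k`-choosable. -/
def IsGroupEdgeChoosable {V : Type u} (G : SimpleGraph V) (k : ℕ) : Prop :=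
  IsGroupChoosable.{u, w} G.lineGraph k

/-- An embedding of `G` in the plane: vertices are distinct points, edges are simple curves
joining the points of their two ends, and the relative interior of an edge contains no vertex and
no point of another edge. -/
structure PlaneEmbedding {V : Type u} (G : SimpleGraph V) where
  point : V → EuclideanSpace ℝ (Fin 2)
  point_injective : Function.Injective point
  curve : G.edgeSet → C(unitInterval, EuclideanSpace ℝ (Fin 2))
  curve_injective : ∀ e, Function.Injective (curve e)
  curve_ends : ∀ e : G.edgeSet, s(curve e 0, curve e 1) = Sym2.map point (e : Sym2 V)
  vertex_not_interior : ∀ (e : G.edgeSet) (t : unitInterval) (v : V),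
    curve e t = point v → t = 0 ∨ t = 1
  curves_meet_at_ends : ∀ e e' : G.edgeSet, e ≠ e' → ∀ t t' : unitInterval,
    curve e t = curve e' t' → t = 0 ∨ t = 1

/-- `G` is planar: it can be drawn in the plane so that its edges intersect only at their ends. -/
def IsPlanar {V : Type u} (G : SimpleGraph V) : Prop :=
  Nonempty G.PlaneEmbedding

end SimpleGraph

/-! ### Cycle space elements and girth -/

namespace SimpleGraph

/-! Write D for the maximum degree. A colour on one edge excludes at most one colour on each
adjacent edge; this is all that is used of the group, the orientation and `f`, and `ConflictSystem`
records it. Edge sets S of the graph are coloured by strong induction, with the lists of size D + 1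
fixed throughout (`IsEdgeSystem.exists_coloring`).

If some edge of S has degree sum at most D + 2 in S, it has at most D neighbours and is coloured
last. Otherwise all degree sums are at least D + 3, so every end of an edge of S has degree at least
3.

If D = 3, then S is cubic and contains a cycle with a chord. Colour everything else by induction.
The chord then has all 4 colours and the cycle edge closing up next to it at least 3, so the chord
can take a colour that leaves 3 chosen colours of that edge intact. The cycle is now coloured
greedily, ending with that edge, which loses at most 2 of the 3 colours
(`IsColoring.exists_extend`).

If D ≥ 4, degree sums are at least 7. Giving each edge 1/deg from both ends yields 12n ≤ 7m for n
non-isolated vertices and m edges. Planarity and girth 5 give 3m ≤ 5n, so 36m ≤ 60n ≤ 35m, which is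
absurd for m > 0.

The planar bound avoids the Jordan curve theorem and Euler's formula. A fine square grid turns a
plane drawing into a minor model in the grid (`nonempty_gridModel`). Gluing cells across unused grid
edges gives faces. Every closed grid chain modulo 2 bounds a set of cells, so the face boundaries
span the cycle space, whose dimension is at least m - n. Each edge lies in at most two face
boundaries, and a nonzero boundary contains a cycle, hence at least 5 edges. Counting incidences
gives 5(m - n) ≤ 2m (`card_edgeFinset_le`). -/

theorem IsAcyclic.exists_existsUnique_adj {V : Type u} [Finite V] {K : SimpleGraph V}
    (h : K.IsAcyclic) {a b : V} (hab : K.Adj a b) : ∃ v, ∃! w, K.Adj v w := by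
  have : Nonempty V := ⟨a⟩
  -- The start of a longest path is a leaf: a neighbour off the path would extend it, and one on the
  -- path other than the second vertex would close a cycle.
  obtain ⟨x, y, p, hp, hmax⟩ := Walk.exists_isPath_forall_isPath_length_le_length K
  have hlen := hmax a b hab.toWalk (by simp [Walk.isPath_def, hab.ne])
  have hnil : ¬p.Nil := by
    intro hn
    rw [← Walk.length_eq_zero_iff] at hn
    simp [hn] at hlen
  refine ⟨x, _, p.adj_snd hnil, fun w hadj ↦ ?_⟩
  apply h.eq_snd_of_adj_start hp hadj
  have : ¬(p.cons hadj.symm).IsPath := by grind [Walk.length_cons]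
  grind [hp.cons]

/-- A nonzero element of the cycle space over the field with two elements, given as a symmetric
function on ordered pairs, has at least as many edges as the girth. -/
theorem two_mul_le_card_of_cycle_space {V : Type u} [Fintype V] {H : SimpleGraph V} {n : ℕ}
    (hn : n ≤ H.egirth) {ζ : V → V → ZMod 2} (hsymm : ∀ a b, ζ a b = ζ b a)
    (hadj : ∀ a b, ζ a b ≠ 0 → H.Adj a b) (hsum : ∀ a, ∑ b, ζ a b = 0) (hne : ζ ≠ 0) :
    2 * n ≤ (Finset.univ.filter fun x : V × V ↦ ζ x.1 x.2 ≠ 0).card := by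
  classical
  let K : SimpleGraph V :=
    { Adj := fun a b ↦ ζ a b ≠ 0
      symm := ⟨fun a b h ↦ by rwa [hsymm b a]⟩
      loopless := ⟨fun a h ↦ (hadj a a h).ne rfl⟩ }
  have hKH : K ≤ H := fun a b h ↦ hadj a b h
  obtain ⟨a, b, hab⟩ : ∃ a b, K.Adj a b := by
    by_contra! hcon
    exact hne (funext fun a ↦ funext fun b ↦ not_not.1 (hcon a b))
  -- A leaf of the support would leave a single nonzero term in its vertex sum.
  have hcyc : ¬K.IsAcyclic := by
    intro hac
    obtain ⟨v, w, hw, huniq⟩ := hac.exists_existsUnique_adj hab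
    have h1 : ∑ b, ζ v b = ζ v w := by
      refine Finset.sum_eq_single w (fun b _ hbw ↦ ?_) (by simp)
      by_contra hb
      exact hbw (huniq b hb)
    exact hw (h1 ▸ hsum v)
  simp only [IsAcyclic, not_forall, not_not] at hcyc
  obtain ⟨v, c, hc⟩ := hcyc
  have h1 : (n : ℕ∞) ≤ c.length := by
    have := egirth_le_length (hc.mapLe hKH)
    rw [Walk.length_map] at this
    exact hn.trans this
  have h2 : c.length ≤ K.edgeFinset.card := hc.isTrail.length_le_card_edgeFinset
  have h3 := K.sum_degrees_eq_twice_card_edges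
  have h4 : (Finset.univ.filter fun x : V × V ↦ ζ x.1 x.2 ≠ 0).card = ∑ v, K.degree v := by
    rw [Finset.card_filter, Fintype.sum_prod_type]
    refine Finset.sum_congr rfl fun v _ ↦ ?_
    rw [← Finset.card_filter, ← card_neighborFinset_eq_degree]
    congr 1
    ext b
    simp [K]
  have h5 : n ≤ c.length := by exact_mod_cast h1
  omega

end SimpleGraph

/-! ### The square grid -/

/-- The four unit vectors of the square grid. -/
def gridDirs : Finset (ℤ × ℤ) := {(1, 0), (-1, 0), (0, 1), (0, -1)}

def GridAdj (p q : ℤ × ℤ) : Prop := q - p ∈ gridDirs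

theorem gridDirs_neg {d : ℤ × ℤ} (h : d ∈ gridDirs) : -d ∈ gridDirs := by
  simp only [gridDirs, Finset.mem_insert, Finset.mem_singleton] at h ⊢
  rcases h with rfl | rfl | rfl | rfl <;> simp

theorem GridAdj.symm {p q : ℤ × ℤ} (h : GridAdj p q) : GridAdj q p := by
  have := gridDirs_neg h
  rwa [neg_sub] at this

theorem sum_gridDirs {M : Type*} [AddCommMonoid M] (F : ℤ × ℤ → M) :
    ∑ d ∈ gridDirs, F d = F (1, 0) + F (-1, 0) + F (0, 1) + F (0, -1) := by
  simp [gridDirs, add_assoc]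

/-- The boundary at `p` of a 1-chain of the grid. -/
def gridBd (z : ℤ × ℤ → ℤ × ℤ → ZMod 2) (p : ℤ × ℤ) : ZMod 2 := ∑ d ∈ gridDirs, z p (p + d)

/-- The cell to the left of the grid edge from `p` to `q`. Cells are named by their lower left
corners. -/
def leftCell (p q : ℤ × ℤ) : ℤ × ℤ :=
  if q - p = (1, 0) then p else if q - p = (-1, 0) then p + (-1, -1)
  else if q - p = (0, 1) then p + (-1, 0) else p + (0, -1)

/-- The 1-chain that consists of the edges between cells where `c` differs. -/
def gridCobd (c : ℤ × ℤ → ZMod 2) (p q : ℤ × ℤ) : ZMod 2 := c (leftCell p q) + c (leftCell q p)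

theorem gridCobd_comm (c : ℤ × ℤ → ZMod 2) (p q : ℤ × ℤ) : gridCobd c p q = gridCobd c q p :=
  add_comm _ _

theorem gridCobd_right (c : ℤ × ℤ → ZMod 2) (i j : ℤ) :
    gridCobd c (i, j) (i + 1, j) = c (i, j) + c (i, j - 1) := by
  simp [gridCobd, leftCell, sub_eq_add_neg]

theorem gridCobd_up (c : ℤ × ℤ → ZMod 2) (i j : ℤ) :
    gridCobd c (i, j) (i, j + 1) = c (i - 1, j) + c (i, j) := by
  simp [gridCobd, leftCell, sub_eq_add_neg]

theorem gridBd_apply (z : ℤ × ℤ → ℤ × ℤ → ZMod 2) (i j : ℤ) :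
    gridBd z (i, j) = z (i, j) (i + 1, j) + z (i, j) (i - 1, j) + z (i, j) (i, j + 1)
      + z (i, j) (i, j - 1) := by
  simp [gridBd, sum_gridDirs, sub_eq_add_neg]

/-- Each of the four cells around `p` borders two of the four edges at `p`, so it is counted twice
modulo 2. -/
theorem gridBd_gridCobd (c : ℤ × ℤ → ZMod 2) (p : ℤ × ℤ) : gridBd (gridCobd c) p = 0 := by
  obtain ⟨i, j⟩ := p
  have h1 := gridCobd_right c (i - 1) j
  have h2 := gridCobd_up c i (j - 1)
  rw [sub_add_cancel] at h1 h2
  rw [gridBd_apply, gridCobd_right, gridCobd_up, gridCobd_comm c _ (i - 1, j),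
    gridCobd_comm c _ (i, j - 1), h1, h2]
  generalize c (i, j) = a, c (i, j - 1) = b, c (i - 1, j) = d, c (i - 1, j - 1) = e
  revert a b d e
  decide

/-- Discrete integration from 0 in both directions. One of the two sums is always empty, and modulo
2 the sign for negative `n` does not matter. -/
theorem exists_int_primitive (φ : ℤ → ZMod 2) : ∃ Φ : ℤ → ZMod 2, ∀ n, Φ (n - 1) + Φ n = φ n := by
  refine ⟨fun n ↦ ∑ i ∈ Finset.Ioc 0 n, φ i + ∑ i ∈ Finset.Ioc n 0, φ i, fun n ↦ ?_⟩
  rcases le_or_gt n 0 with h | h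
  · have h1 : Finset.Ioc 0 (n - 1) = ∅ := Finset.Ioc_eq_empty (by omega)
    have h2 : Finset.Ioc 0 n = ∅ := Finset.Ioc_eq_empty (by omega)
    have h3 : Finset.Ioc (n - 1) 0 = insert n (Finset.Ioc n 0) := by
      ext i; simp only [Finset.mem_Ioc, Finset.mem_insert]; omega
    simp only [h1, h2, h3, Finset.sum_empty, zero_add]
    rw [Finset.sum_insert (by simp), add_assoc, CharTwo.add_self_eq_zero, add_zero]
  · have h1 : Finset.Ioc (n - 1) 0 = ∅ := Finset.Ioc_eq_empty (by omega)
    have h2 : Finset.Ioc n 0 = ∅ := Finset.Ioc_eq_empty (by omega)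
    have h3 : Finset.Ioc 0 n = insert n (Finset.Ioc 0 (n - 1)) := by
      ext i; simp only [Finset.mem_Ioc, Finset.mem_insert]; omega
    simp only [h1, h2, h3, Finset.sum_empty, add_zero]
    rw [Finset.sum_insert (by simp), add_left_comm, CharTwo.add_self_eq_zero, add_zero]

/-- A closed 1-chain of the grid is the coboundary of a function on the cells. -/
theorem exists_gridCobd_eq {z : ℤ × ℤ → ℤ × ℤ → ZMod 2} (hsymm : ∀ p q, z p q = z q p)
    (hz : ∀ p, gridBd z p = 0) :
    ∃ c : ℤ × ℤ → ZMod 2, ∀ p q, GridAdj p q → gridCobd c p q = z p q := by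
  -- In row `j` the vertical edges determine `c` up to a constant: `Φ j` is one solution. Closedness
  -- of `z` makes its error on the horizontal edges between rows `j - 1` and `j` independent of `i`.
  choose Φ hΦ using fun j : ℤ ↦ exists_int_primitive fun i ↦ z (i, j) (i, j + 1)
  have hstep : ∀ i j : ℤ, z (i, j) (i + 1, j) + Φ j i + Φ (j - 1) i
      = z (i - 1, j) (i, j) + Φ j (i - 1) + Φ (j - 1) (i - 1) := by
    intro i j
    have h1 := hz (i, j)
    have h2 := hΦ j i
    have h3 := hΦ (j - 1) i
    rw [gridBd_apply, hsymm _ (i - 1, j), hsymm _ (i, j - 1)] at h1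
    simp only [sub_add_cancel] at h3
    rw [← h2, ← h3] at h1
    revert h1
    generalize z (i, j) (i + 1, j) = a, Φ j i = b, Φ (j - 1) i = d, z (i - 1, j) (i, j) = e,
      Φ j (i - 1) = f, Φ (j - 1) (i - 1) = g
    revert a b d e f g
    decide
  have hconst : ∀ i j : ℤ, z (i, j) (i + 1, j) + Φ j i + Φ (j - 1) i
      = z (0, j) (0 + 1, j) + Φ j 0 + Φ (j - 1) 0 := by
    intro i j
    induction i using Int.induction_on with
    | zero => rfl
    | succ i ih => rw [← ih, hstep]; simp
    | pred i ih => rw [← ih, hstep (-i) j]; simp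
  -- The row constants `K` absorb that error, by a second integration in `j`.
  obtain ⟨K, hK⟩ := exists_int_primitive fun j ↦ z (0, j) (0 + 1, j) + Φ j 0 + Φ (j - 1) 0
  let c : ℤ × ℤ → ZMod 2 := fun p ↦ Φ p.2 p.1 + K p.2
  have hr : ∀ i j, gridCobd c (i, j) (i + 1, j) = z (i, j) (i + 1, j) := by
    intro i j
    rw [gridCobd_right]
    have h1 := hK j
    rw [← hconst i j] at h1
    revert h1
    simp only [c]
    generalize z (i, j) (i + 1, j) = a, Φ j i = b, Φ (j - 1) i = d, K j = e, K (j - 1) = f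
    revert a b d e f
    decide
  have hu : ∀ i j, gridCobd c (i, j) (i, j + 1) = z (i, j) (i, j + 1) := by
    intro i j
    rw [gridCobd_up, ← hΦ j i]
    simp only [c]
    generalize Φ j i = b, Φ j (i - 1) = d, K j = e
    revert b d e
    decide
  refine ⟨c, fun p q hpq ↦ ?_⟩
  obtain ⟨i, j⟩ := p
  obtain ⟨d, hd, rfl⟩ : ∃ d ∈ gridDirs, q = (i, j) + d := ⟨_, hpq, by abel⟩
  simp only [gridDirs, Finset.mem_insert, Finset.mem_singleton] at hd
  rcases hd with rfl | rfl | rfl | rfl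
  · simpa using hr i j
  · have := hr (i - 1) j
    rw [sub_add_cancel] at this
    rw [gridCobd_comm, hsymm]
    simpa [sub_eq_add_neg] using this
  · simpa using hu i j
  · have := hu i (j - 1)
    rw [sub_add_cancel] at this
    rw [gridCobd_comm, hsymm]
    simpa [sub_eq_add_neg] using this

/-! ### Minor models in the grid and chains along paths -/

/-- `p` and `q` are joined by a path of the grid inside `B`. -/
def GridJoined (B : Set (ℤ × ℤ)) (p q : ℤ × ℤ) : Prop :=
  Relation.ReflTransGen (fun a b ↦ GridAdj a b ∧ a ∈ B ∧ b ∈ B) p q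

theorem GridJoined.symm {B : Set (ℤ × ℤ)} {p q : ℤ × ℤ} (h : GridJoined B p q) :
    GridJoined B q p := by
  induction h with
  | refl => exact .refl
  | tail _ h ih => exact .head ⟨h.1.symm, h.2.2, h.2.1⟩ ih

theorem GridJoined.mono {B C : Set (ℤ × ℤ)} (hBC : B ⊆ C) {p q : ℤ × ℤ} (h : GridJoined B p q) :
    GridJoined C p q :=
  Relation.ReflTransGen.mono (fun _ _ h ↦ ⟨h.1, hBC h.2.1, hBC h.2.2⟩) _ _ h

/-- A model of `G` as a minor of the square grid. -/
structure GridModel {V : Type u} (G : SimpleGraph V) where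
  branch : V → Finset (ℤ × ℤ)
  joined : ∀ v, ∀ p ∈ branch v, ∀ q ∈ branch v, GridJoined (branch v) p q
  disjoint : ∀ v w p, p ∈ branch v → p ∈ branch w → v = w
  port : V → V → ℤ × ℤ
  port_mem : ∀ v w, G.Adj v w → port v w ∈ branch v
  port_adj : ∀ v w, G.Adj v w → GridAdj (port v w) (port w v)

theorem gridBd_add (z z' : ℤ × ℤ → ℤ × ℤ → ZMod 2) (p : ℤ × ℤ) :
    gridBd (fun a b ↦ z a b + z' a b) p = gridBd z p + gridBd z' p :=
  Finset.sum_add_distrib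

theorem gridBd_sum {ι : Type*} (s : Finset ι) (z : ι → ℤ × ℤ → ℤ × ℤ → ZMod 2) (p : ℤ × ℤ) :
    gridBd (fun a b ↦ ∑ i ∈ s, z i a b) p = ∑ i ∈ s, gridBd (z i) p :=
  Finset.sum_comm

theorem gridBd_mul (x : ZMod 2) (z : ℤ × ℤ → ℤ × ℤ → ZMod 2) (p : ℤ × ℤ) :
    gridBd (fun a b ↦ x * z a b) p = x * gridBd z p :=
  (Finset.mul_sum _ _ _).symm

/-- The chain is not symmetric: it is the edge `xy` seen from `x` only. Symmetric chains are built
by adding both halves, and their boundaries are computed half by half. -/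
theorem gridBd_single {x y : ℤ × ℤ} (h : GridAdj x y) (p : ℤ × ℤ) :
    gridBd (fun a b ↦ (if a = x then 1 else 0) * if b = y then 1 else 0) p
      = if p = x then 1 else 0 := by
  unfold gridBd
  rw [← Finset.mul_sum]
  by_cases hp : p = x
  · subst hp
    have : ∀ d, (p + d = y) ↔ d = y - p := fun d ↦ by rw [eq_sub_iff_add_eq, add_comm]
    simp only [this]
    rw [Finset.sum_ite_eq' gridDirs (y - p), if_pos (show y - p ∈ gridDirs from h)]
    simp
  · simp [hp]

/-- The edges of the path counted modulo 2: each new edge cancels the old end and creates the next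
one. -/
theorem GridJoined.exists_chain {B : Set (ℤ × ℤ)} {p q : ℤ × ℤ} (h : GridJoined B p q) :
    ∃ w : ℤ × ℤ → ℤ × ℤ → ZMod 2, (∀ a b, w a b = w b a) ∧ (∀ a b, w a b ≠ 0 → a ∈ B ∧ b ∈ B) ∧
      ∀ a, gridBd w a = (if a = p then 1 else 0) + if a = q then 1 else 0 := by
  induction h with
  | refl => exact ⟨0, by simp, by simp, fun a ↦ by
      rw [CharTwo.add_self_eq_zero]; exact Finset.sum_const_zero⟩
  | @tail b c _ hbc ih =>
    obtain ⟨w, hs, hB, hw⟩ := ih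
    refine ⟨fun x y ↦ w x y + ((if x = b then 1 else 0) * (if y = c then 1 else 0)
      + (if x = c then 1 else 0) * (if y = b then 1 else 0)), fun x y ↦ ?_, fun x y hxy ↦ ?_,
      fun a ↦ ?_⟩
    · simp only [hs x y]; ring
    · by_contra hcon
      have h1 : w x y = 0 := by_contra fun h ↦ hcon (hB _ _ h)
      refine hxy ?_
      simp only [h1]
      have h2 : ¬(x = b ∧ y = c) := by rintro ⟨rfl, rfl⟩; exact hcon hbc.2
      have h3 : ¬(x = c ∧ y = b) := by rintro ⟨rfl, rfl⟩; exact hcon hbc.2.symm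
      simp only [← ite_and, mul_ite, mul_one, mul_zero]
      rw [if_neg (by tauto), if_neg (by tauto)]
      simp
    · rw [gridBd_add, gridBd_add, gridBd_single hbc.1, gridBd_single hbc.1.symm, hw]
      generalize (if a = p then (1 : ZMod 2) else 0) = x, (if a = b then (1 : ZMod 2) else 0) = y,
        (if a = c then (1 : ZMod 2) else 0) = t
      revert x y t
      decide

/-! ### Faces of a model, generation of the cycle space, and the edge bound -/

namespace GridModel

open SimpleGraph

variable {V : Type u} {G : SimpleGraph V} (M : GridModel G)

/-- The grid edge `pq` is used by the model. -/
def Used (p q : ℤ × ℤ) : Prop :=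
  (∃ v, p ∈ M.branch v ∧ q ∈ M.branch v) ∨ ∃ v w, G.Adj v w ∧ p = M.port v w ∧ q = M.port w v

/-- The faces of the model: classes of cells joined through unused edges. -/
def Face : Type :=
  Quot fun a b ↦ ∃ p q, GridAdj p q ∧ ¬M.Used p q ∧ a = leftCell p q ∧ b = leftCell q p

/-- The face that contains a cell. -/
def faceOf (c : ℤ × ℤ) : M.Face := Quot.mk _ c

theorem faceOf_leftCell {p q : ℤ × ℤ} (h : GridAdj p q) (hpq : ¬M.Used p q) :
    M.faceOf (leftCell p q) = M.faceOf (leftCell q p) :=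
  Quot.sound ⟨p, q, h, hpq, rfl, rfl⟩

open Classical in
/-- The boundary of a face in the grid. -/
noncomputable def faceChain (f : M.Face) : ℤ × ℤ → ℤ × ℤ → ZMod 2 :=
  gridCobd fun c ↦ if M.faceOf c = f then 1 else 0

open Classical in
/-- The boundary of a face, as an element of the cycle space of `G`. -/
noncomputable def faceBoundary (f : M.Face) (v w : V) : ZMod 2 :=
  if G.Adj v w then M.faceChain f (M.port v w) (M.port w v) else 0

theorem faceChain_eq_zero (f : M.Face) {p q : ℤ × ℤ} (h : GridAdj p q) (hpq : ¬M.Used p q) :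
    M.faceChain f p q = 0 := by
  unfold faceChain gridCobd
  beta_reduce
  rw [M.faceOf_leftCell h hpq]
  exact CharTwo.add_self_eq_zero (R := ZMod 2) _

theorem faceBoundary_comm (f : M.Face) (v w : V) :
    M.faceBoundary f v w = M.faceBoundary f w v := by
  unfold faceBoundary
  rw [faceChain, gridCobd_comm]
  classical exact if_congr (G.adj_comm v w) rfl rfl

theorem port_injective {v w w' : V} (h : G.Adj v w) (h' : G.Adj v w')
    (he : M.port w v = M.port w' v) : w = w' :=
  M.disjoint _ _ _ (M.port_mem _ _ h.symm) (he ▸ M.port_mem _ _ h'.symm)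

/-- Off-diagonal terms come in equal pairs. This cancels the grid edges inside a branch set, which
are seen from both ends. -/
theorem sum_sum_eq_zero_of_symm {ι : Type*} [DecidableEq ι] (s : Finset ι) {z : ι → ι → ZMod 2}
    (hs : ∀ a b, z a b = z b a) (h0 : ∀ a, z a a = 0) : ∑ a ∈ s, ∑ b ∈ s, z a b = 0 := by
  induction s using Finset.induction_on with
  | empty => simp
  | insert a s ha ih =>
    rw [Finset.sum_insert ha]
    simp only [Finset.sum_insert ha, Finset.sum_add_distrib, ih, h0, zero_add, add_zero]
    rw [Finset.sum_congr rfl fun b _ ↦ hs b a]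
    exact CharTwo.add_self_eq_zero _

open Classical in
/-- A closed 1-chain on the used edges restricts to an element of the cycle space of `G`. -/
theorem sum_port_eq_zero [Fintype V] {z : ℤ × ℤ → ℤ × ℤ → ZMod 2} (hs : ∀ p q, z p q = z q p)
    (hz : ∀ p, gridBd z p = 0) (hused : ∀ p q, GridAdj p q → ¬M.Used p q → z p q = 0) (v : V) :
    ∑ w, (if G.Adj v w then z (M.port v w) (M.port w v) else 0) = 0 := by
  -- The vanishing boundaries are summed over the branch set of `v`, which amounts to contracting
  -- it. A grid edge leaving `p` is internal, or the port edge of exactly one neighbour, or unused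
  -- and hence of value 0.
  have key : ∀ p ∈ M.branch v, ∀ d ∈ gridDirs,
      z p (p + d) = (if p + d ∈ M.branch v then z p (p + d) else 0) +
        ∑ w, if G.Adj v w ∧ p = M.port v w ∧ p + d = M.port w v then z p (p + d) else 0 := by
    intro p hp d hd
    by_cases h1 : p + d ∈ M.branch v
    · rw [if_pos h1, Finset.sum_eq_zero, add_zero]
      intro w _
      refine if_neg ?_
      rintro ⟨hvw, _, h2⟩
      exact hvw.ne (M.disjoint _ _ _ h1 (h2 ▸ M.port_mem _ _ hvw.symm))
    · rw [if_neg h1, zero_add]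
      by_cases h2 : ∃ w, G.Adj v w ∧ p = M.port v w ∧ p + d = M.port w v
      · obtain ⟨w, hw⟩ := h2
        rw [Finset.sum_eq_single w, if_pos hw]
        · intro w' _ hne
          refine if_neg fun hw' ↦ hne ?_
          exact M.port_injective hw'.1 hw.1 (hw'.2.2.symm.trans hw.2.2)
        · simp
      · rw [Finset.sum_eq_zero fun w _ ↦ if_neg fun hw ↦ h2 ⟨w, hw⟩]
        refine hused _ _ (by simpa [GridAdj] using hd) ?_
        rintro (⟨x, hx, hx'⟩ | ⟨x, w, hxw, rfl, hw⟩)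
        · obtain rfl := M.disjoint _ _ _ hp hx
          exact h1 hx'
        · obtain rfl := M.disjoint _ _ _ hp (M.port_mem _ _ hxw)
          exact h2 ⟨w, hxw, rfl, hw⟩
  have h0 : ∑ p ∈ M.branch v, ∑ d ∈ gridDirs, z p (p + d) = 0 :=
    Finset.sum_eq_zero fun p _ ↦ hz p
  rw [Finset.sum_congr rfl fun p hp ↦ Finset.sum_congr rfl (key p hp)] at h0
  simp only [Finset.sum_add_distrib] at h0
  have hin : ∑ p ∈ M.branch v, ∑ d ∈ gridDirs,
      (if p + d ∈ M.branch v then z p (p + d) else 0) = 0 := by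
    refine Eq.trans ?_ (sum_sum_eq_zero_of_symm (M.branch v)
      (z := fun p q ↦ if GridAdj p q then z p q else 0) ?_ ?_)
    · refine Finset.sum_congr rfl fun p _ ↦ ?_
      rw [← Finset.sum_filter, ← Finset.sum_filter]
      refine Finset.sum_bij' (fun d _ ↦ p + d) (fun q _ ↦ q - p) ?_ ?_ ?_ ?_ ?_
      · intro d hd
        rw [Finset.mem_filter] at hd ⊢
        exact ⟨hd.2, by simpa [GridAdj] using hd.1⟩
      · intro q hq
        rw [Finset.mem_filter] at hq ⊢
        exact ⟨hq.2, by simpa using hq.1⟩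
      · intros; abel
      · intros; abel
      · intros; rfl
    · intro a b
      have : GridAdj a b ↔ GridAdj b a := ⟨GridAdj.symm, GridAdj.symm⟩
      simp only [this, hs a b]
    · intro a
      refine if_neg ?_
      simp [GridAdj, gridDirs, Prod.ext_iff]
  rw [hin, zero_add] at h0
  rw [Finset.sum_congr rfl fun p _ ↦ Finset.sum_comm, Finset.sum_comm] at h0
  refine Eq.trans ?_ h0
  refine Finset.sum_congr rfl fun w _ ↦ ?_
  by_cases hvw : G.Adj v w
  · rw [if_pos hvw, Finset.sum_eq_single (M.port v w),
      Finset.sum_eq_single (M.port w v - M.port v w)]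
    · rw [add_sub_cancel, if_pos ⟨hvw, rfl, rfl⟩]
    · intro d _ hd
      refine if_neg fun h ↦ hd ?_
      rw [← h.2.2, add_sub_cancel_left]
    · intro h
      exact absurd (M.port_adj _ _ hvw) h
    · intro p _ hp
      exact Finset.sum_eq_zero fun d _ ↦ if_neg fun h ↦ hp h.2.1
    · intro h
      exact absurd (M.port_mem _ _ hvw) h
  · simp [hvw]

theorem faceBoundary_sum [Fintype V] (f : M.Face) (v : V) : ∑ w, M.faceBoundary f v w = 0 :=
  M.sum_port_eq_zero (gridCobd_comm _) (gridBd_gridCobd _) (fun _ _ ↦ M.faceChain_eq_zero f) v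

/-- Every element of the cycle space of `G` lifts to a closed 1-chain on the used edges. -/
theorem exists_lift [Fintype V] {ζ : V → V → ZMod 2} (hsymm : ∀ a b, ζ a b = ζ b a)
    (hadj : ∀ a b, ζ a b ≠ 0 → G.Adj a b) (hsum : ∀ a, ∑ b, ζ a b = 0) :
    ∃ z : ℤ × ℤ → ℤ × ℤ → ZMod 2, (∀ p q, z p q = z q p) ∧ (∀ p, gridBd z p = 0) ∧
      (∀ p q, ¬M.Used p q → z p q = 0) ∧
      ∀ v w, G.Adj v w → z (M.port v w) (M.port w v) = ζ v w := by
  classical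
  -- Each branch set gets a root. It may be empty at an isolated vertex, where the value 0 plays no
  -- role.
  have hroot : ∀ v, ∃ r, (M.branch v).Nonempty → r ∈ M.branch v := fun v ↦ by
    by_cases h : (M.branch v).Nonempty
    · exact ⟨h.choose, fun _ ↦ h.choose_spec⟩
    · exact ⟨0, fun h' ↦ absurd h' h⟩
  choose r hr using hroot
  have hchain : ∀ v w, ∃ x : ℤ × ℤ → ℤ × ℤ → ZMod 2, (∀ a b, x a b = x b a) ∧
      (∀ a b, x a b ≠ 0 → a ∈ M.branch v ∧ b ∈ M.branch v) ∧ (G.Adj v w →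
      ∀ a, gridBd x a = (if a = r v then 1 else 0) + if a = M.port v w then 1 else 0) := by
    intro v w
    by_cases h : G.Adj v w
    · have hm := M.port_mem v w h
      obtain ⟨x, h1, h2, h3⟩ := (M.joined v _ (hr v ⟨_, hm⟩) _ hm).exists_chain
      exact ⟨x, h1, h2, fun _ ↦ h3⟩
    · exact ⟨0, by simp, by simp, fun h' ↦ absurd h' h⟩
  choose x hxs hxB hx using hchain
  let e : V → V → ℤ × ℤ → ℤ × ℤ → ZMod 2 := fun v w p q ↦
    (if p = M.port v w then 1 else 0) * if q = M.port w v then 1 else 0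
  have hz : ∀ v w, G.Adj v w → ∀ p, gridBd (e v w) p = if p = M.port v w then 1 else 0 :=
    fun v w h p ↦ gridBd_single (M.port_adj v w h) p
  -- Each half edge is routed inside the branch set of `v` from its port to the root. The ports
  -- cancel, and at the root the total is the vertex sum of `ζ`, which is 0.
  refine ⟨fun p q ↦ ∑ v, ∑ w, ζ v w * (x v w p q + e v w p q), ?_, ?_, ?_, ?_⟩
  · intro p q
    simp only [mul_add, Finset.sum_add_distrib]
    congr 1
    · simp only [hxs]
    · rw [Finset.sum_comm]
      refine Finset.sum_congr rfl fun v _ ↦ Finset.sum_congr rfl fun w _ ↦ ?_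
      simp only [e, hsymm w v]
      ring
  · intro p
    have h1 : ∀ v w, gridBd (fun p q ↦ ζ v w * (x v w p q + e v w p q)) p
        = ζ v w * if p = r v then 1 else 0 := by
      intro v w
      rw [gridBd_mul, gridBd_add]
      by_cases h : G.Adj v w
      · rw [hx v w h, hz v w h, add_assoc, CharTwo.add_self_eq_zero, add_zero]
      · rw [not_not.1 (mt (hadj v w) h)]
        simp
    rw [gridBd_sum]
    refine Finset.sum_eq_zero fun v _ ↦ ?_
    rw [gridBd_sum]
    simp only [h1]
    rw [← Finset.sum_mul, hsum, zero_mul]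
  · intro p q hpq
    refine Finset.sum_eq_zero fun v _ ↦ Finset.sum_eq_zero fun w _ ↦ ?_
    by_cases h : G.Adj v w
    · have h1 : x v w p q = 0 := by_contra fun h' ↦ hpq (Or.inl ⟨v, hxB _ _ _ _ h'⟩)
      have h2 : e v w p q = 0 := by
        simp only [e, ← ite_and, mul_ite, mul_one, mul_zero]
        exact if_neg fun h' ↦ hpq (Or.inr ⟨v, w, h, h'.2, h'.1⟩)
      rw [h1, h2, add_zero, mul_zero]
    · rw [not_not.1 (mt (hadj v w) h), zero_mul]
  · intro v w h
    have h1 : ∀ v' w', x v' w' (M.port v w) (M.port w v) = 0 := by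
      intro v' w'
      by_contra h'
      have h2 := hxB _ _ _ _ h'
      exact h.ne ((M.disjoint _ _ _ (M.port_mem _ _ h) h2.1).trans
        (M.disjoint _ _ _ (M.port_mem _ _ h.symm) h2.2).symm)
    have h2 : ∀ v' w', (v' ≠ v ∨ w' ≠ w) → ζ v' w' * e v' w' (M.port v w) (M.port w v) = 0 := by
      intro v' w' hne
      by_contra h'
      have h3 := hadj v' w' (left_ne_zero_of_mul h')
      have h4 := right_ne_zero_of_mul h'
      simp only [e, ← ite_and, mul_ite, mul_one, mul_zero] at h4
      have h5 := (ite_ne_right_iff.1 h4).1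
      rcases hne with hne | hne
      · exact hne (M.disjoint _ _ _ (M.port_mem _ _ h3) (h5.2 ▸ M.port_mem _ _ h))
      · exact hne (M.disjoint _ _ _ (M.port_mem _ _ h3.symm) (h5.1 ▸ M.port_mem _ _ h.symm))
    simp only [h1, zero_add]
    rw [Finset.sum_eq_single v, Finset.sum_eq_single w]
    · simp [e]
    · exact fun w' _ hw ↦ h2 _ _ (Or.inr hw)
    · simp
    · exact fun v' _ hv ↦ Finset.sum_eq_zero fun w' _ ↦ h2 _ _ (Or.inl hv)
    · simp

open Classical in
/-- The faces on both sides of the edges of `G`. -/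
noncomputable def edgeFaces [Fintype V] : Finset M.Face :=
  Finset.univ.image fun x : V × V ↦ M.faceOf (leftCell (M.port x.1 x.2) (M.port x.2 x.1))

open Classical in
theorem faceBoundary_eq {v w : V} (h : G.Adj v w) (f : M.Face) : M.faceBoundary f v w =
    (if M.faceOf (leftCell (M.port v w) (M.port w v)) = f then 1 else 0)
      + if M.faceOf (leftCell (M.port w v) (M.port v w)) = f then 1 else 0 :=
  if_pos h

/-- The face boundaries span the cycle space. -/
theorem exists_eq_sum_faceBoundary [Fintype V] {ζ : V → V → ZMod 2}
    (hsymm : ∀ a b, ζ a b = ζ b a) (hadj : ∀ a b, ζ a b ≠ 0 → G.Adj a b)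
    (hsum : ∀ a, ∑ b, ζ a b = 0) :
    ∃ c : M.Face → ZMod 2, ζ = ∑ f ∈ M.edgeFaces, c f • M.faceBoundary f := by
  classical
  obtain ⟨z, hzs, hz, hused, hport⟩ := M.exists_lift hsymm hadj hsum
  obtain ⟨c, hc⟩ := exists_gridCobd_eq hzs hz
  -- The lift vanishes on unused edges, so its potential agrees on cells glued there and descends to
  -- faces.
  let c' : M.Face → ZMod 2 := Quot.lift c (by
    rintro a b ⟨p, q, hpq, hu, rfl, rfl⟩
    exact CharTwo.add_eq_zero.1 ((hc p q hpq).trans (hused p q hu)))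
  refine ⟨c', funext fun v ↦ funext fun w ↦ ?_⟩
  simp only [Finset.sum_apply, Pi.smul_apply, smul_eq_mul]
  by_cases h : G.Adj v w
  · have hm : ∀ v w, M.faceOf (leftCell (M.port v w) (M.port w v)) ∈ M.edgeFaces := fun v w ↦
      Finset.mem_image.2 ⟨(v, w), Finset.mem_univ _, rfl⟩
    simp only [M.faceBoundary_eq h, mul_add, mul_ite, mul_one, mul_zero, Finset.sum_add_distrib]
    rw [Finset.sum_ite_eq, Finset.sum_ite_eq, if_pos (hm _ _), if_pos (hm _ _), ← hport v w h,
      ← hc _ _ (M.port_adj v w h)]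
    rfl
  · rw [not_not.1 (mt (hadj v w) h), Finset.sum_eq_zero]
    intro f _
    simp [faceBoundary, h]

open Classical in
/-- The edge count of a graph of girth at least `n` with a model in the grid. -/
theorem card_edgeFinset_le [Fintype V] (M : GridModel G) {n : ℕ} (hn : n ≤ G.egirth) :
    n * G.edgeFinset.card ≤
      2 * G.edgeFinset.card + n * (Finset.univ.filter fun v ↦ ∃ w, G.Adj v w).card := by
  let Φ := M.edgeFaces.filter fun f ↦ M.faceBoundary f ≠ 0
  -- double counting of the pairs of faces and edges
  have hcount : n * Φ.card ≤ 2 * G.edgeFinset.card := by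
    have h1 : ∑ f ∈ Φ, (Finset.univ.filter fun x : V × V ↦ M.faceBoundary f x.1 x.2 ≠ 0).card
        ≤ ∑ x : V × V, if G.Adj x.1 x.2 then 2 else 0 := by
      simp only [Finset.card_filter]
      rw [Finset.sum_comm]
      refine Finset.sum_le_sum fun x _ ↦ ?_
      rw [← Finset.card_filter]
      split_ifs with h
      · refine (Finset.card_le_card (t := {M.faceOf (leftCell (M.port x.1 x.2) (M.port x.2 x.1)),
          M.faceOf (leftCell (M.port x.2 x.1) (M.port x.1 x.2))}) fun f hf ↦ ?_).trans
          Finset.card_le_two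
        rw [Finset.mem_filter, M.faceBoundary_eq h] at hf
        by_contra hcon
        simp only [Finset.mem_insert, Finset.mem_singleton, not_or] at hcon
        exact hf.2 (by rw [if_neg (Ne.symm hcon.1), if_neg (Ne.symm hcon.2), add_zero])
      · rw [Nat.le_zero, Finset.card_eq_zero, Finset.filter_eq_empty_iff]
        intro f _
        simp [faceBoundary, h]
    have h2 : ∑ f ∈ Φ, 2 * n ≤
        ∑ f ∈ Φ, (Finset.univ.filter fun x : V × V ↦ M.faceBoundary f x.1 x.2 ≠ 0).card := by
      refine Finset.sum_le_sum fun f hf ↦ two_mul_le_card_of_cycle_space hn (M.faceBoundary_comm f)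
        (fun a b h ↦ ?_) (M.faceBoundary_sum f) (Finset.mem_filter.1 hf).2
      by_contra hab
      exact h (if_neg hab)
    have h3 : ∑ x : V × V, (if G.Adj x.1 x.2 then 2 else 0) = 2 * (2 * G.edgeFinset.card) := by
      rw [← G.sum_degrees_eq_twice_card_edges, Fintype.sum_prod_type, Finset.mul_sum]
      refine Finset.sum_congr rfl fun v _ ↦ ?_
      rw [← card_neighborFinset_eq_degree, ← Finset.sum_filter, Finset.sum_const, smul_eq_mul,
        mul_comm]
      congr 2
      ext b
      simp
    rw [Finset.sum_const, smul_eq_mul] at h2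
    have := h2.trans (h1.trans h3.le)
    nlinarith
  -- the dimension of the cycle space
  have hdim : G.edgeFinset.card ≤
      (Finset.univ.filter fun v ↦ ∃ w, G.Adj v w).card + Φ.card := by
    let Θ : (G.edgeSet → ZMod 2) →ₗ[ZMod 2] V → V → ZMod 2 :=
      { toFun := fun x v w ↦ if h : G.Adj v w then x ⟨s(v, w), h⟩ else 0
        map_add' := fun x y ↦ by
          funext v w
          by_cases h : G.Adj v w <;> simp [h]
        map_smul' := fun a x ↦ by
          funext v w
          by_cases h : G.Adj v w <;> simp [h] }
    have hΘ : Function.Injective Θ := by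
      intro x y hxy
      funext ⟨e, he⟩
      induction e with
      | _ v w =>
        have h : G.Adj v w := he
        simpa [Θ, h] using congrFun (congrFun hxy v) w
    -- The boundary map. Dropping isolated vertices from the target leaves its kernel the cycle
    -- space and bounds its rank by the number of non-isolated vertices.
    let β : (G.edgeSet → ZMod 2) →ₗ[ZMod 2] ({v // ∃ w, G.Adj v w} → ZMod 2) :=
      { toFun := fun x v ↦ ∑ w, Θ x v w
        map_add' := fun x y ↦ by
          funext v
          simp [Finset.sum_add_distrib]
        map_smul' := fun a x ↦ by
          funext v
          simp [Finset.mul_sum] }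
    have hker : Submodule.map Θ (LinearMap.ker β) ≤
        Submodule.span (ZMod 2) (Φ.image M.faceBoundary : Finset (V → V → ZMod 2)) := by
      rintro _ ⟨x, hx, rfl⟩
      have hxv : ∀ v, ∑ w, Θ x v w = 0 := by
        intro v
        by_cases hv : ∃ w, G.Adj v w
        · exact congrFun hx ⟨v, hv⟩
        · refine Finset.sum_eq_zero fun w _ ↦ dif_neg fun h ↦ hv ⟨w, h⟩
      obtain ⟨c, hc⟩ := M.exists_eq_sum_faceBoundary (ζ := Θ x) (fun a b ↦ by
        simp only [Θ, LinearMap.coe_mk, AddHom.coe_mk, G.adj_comm a b, Sym2.eq_swap (a := a)])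
        (fun a b h ↦ by
          by_contra hab
          exact h (dif_neg hab)) hxv
      rw [hc, ← Finset.sum_filter_of_ne (p := fun f ↦ M.faceBoundary f ≠ 0)]
      · refine Submodule.sum_mem _ fun f hf ↦ Submodule.smul_mem _ _ (Submodule.subset_span ?_)
        exact Finset.mem_coe.2 (Finset.mem_image_of_mem _ hf)
      · intro f _ hf h0
        exact hf (by rw [h0, smul_zero])
    have h1 := LinearMap.finrank_range_add_finrank_ker β
    have h2 : Module.finrank (ZMod 2) (LinearMap.range β) ≤ _ := Submodule.finrank_le _
    have h3 := (Submodule.finrank_mono hker).trans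
      ((finrank_span_finset_le_card _).trans Finset.card_image_le)
    rw [(Submodule.equivMapOfInjective Θ hΘ _).symm.finrank_eq] at h3
    rw [Module.finrank_fintype_fun_eq_card] at h1 h2
    rw [Fintype.card_subtype] at h2
    rw [edgeFinset_card]
    omega
  nlinarith

end GridModel

/-! ### Neighbourhoods in a fine grid -/

/-- The grid point `p` of mesh `ε` is close to the point `x` of the plane. -/
def GridNear (ε : ℝ) (x : EuclideanSpace ℝ (Fin 2)) (p : ℤ × ℤ) : Prop :=
  |ε * p.1 - x 0| < ε ∧ |ε * p.2 - x 1| < ε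

def gridNhd (ε : ℝ) (X : Set (EuclideanSpace ℝ (Fin 2))) : Set (ℤ × ℤ) :=
  {p | ∃ x ∈ X, GridNear ε x p}

theorem exists_gridNear {ε : ℝ} (hε : 0 < ε) (x : EuclideanSpace ℝ (Fin 2)) :
    ∃ p, GridNear ε x p := by
  have key : ∀ t : ℝ, |ε * ⌊t / ε⌋ - t| < ε := by
    intro t
    have h1 := Int.floor_le (t / ε)
    have h2 := Int.lt_floor_add_one (t / ε)
    rw [le_div_iff₀ hε] at h1
    rw [div_lt_iff₀ hε] at h2
    rw [abs_lt]
    constructor <;> nlinarith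
  exact ⟨(⌊x 0 / ε⌋, ⌊x 1 / ε⌋), key _, key _⟩

/-- Two grid points near `x` differ by at most 1 in each coordinate, and the corner `(q1, p2)`
between them is again near `x`. -/
theorem gridJoined_gridNhd_of_near {ε : ℝ} (hε : 0 < ε) {X : Set (EuclideanSpace ℝ (Fin 2))}
    {x : EuclideanSpace ℝ (Fin 2)} (hx : x ∈ X) {p q : ℤ × ℤ} (hp : GridNear ε x p)
    (hq : GridNear ε x q) : GridJoined (gridNhd ε X) p q := by
  have key : ∀ {a b : ℤ} {t : ℝ}, |ε * a - t| < ε → |ε * b - t| < ε →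
      b - a = 0 ∨ b - a = 1 ∨ b - a = -1 := by
    intro a b t ha hb
    rw [abs_lt] at ha hb
    have h1 : (b : ℝ) - a < 2 := by nlinarith
    have h2 : (-2 : ℝ) < b - a := by nlinarith
    have h3 : b - a < 2 := by exact_mod_cast h1
    have h4 : -2 < b - a := by exact_mod_cast h2
    omega
  obtain ⟨p1, p2⟩ := p
  obtain ⟨q1, q2⟩ := q
  have hm : GridNear ε x (q1, p2) := ⟨hq.1, hp.2⟩
  have s1 : GridJoined (gridNhd ε X) (p1, p2) (q1, p2) := by
    rcases key hp.1 hq.1 with h | h | h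
    · obtain rfl : q1 = p1 := by simp only at h; omega
      exact .refl
    all_goals
      refine .single ⟨?_, ⟨x, hx, hp⟩, ⟨x, hx, hm⟩⟩
      simp only at h
      simp [GridAdj, gridDirs, h]
  have s2 : GridJoined (gridNhd ε X) (q1, p2) (q1, q2) := by
    rcases key hp.2 hq.2 with h | h | h
    · obtain rfl : q2 = p2 := by simp only at h; omega
      exact .refl
    all_goals
      refine .single ⟨?_, ⟨x, hx, hm⟩, ⟨x, hx, hq⟩⟩
      simp only at h
      simp [GridAdj, gridDirs, h]
  exact s1.trans s2

theorem isOpen_setOf_gridNear (ε : ℝ) (p : ℤ × ℤ) : IsOpen {x | GridNear ε x p} := by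
  have key : ∀ (c : ℝ) (i : Fin 2), IsOpen {x : EuclideanSpace ℝ (Fin 2) | |c - x i| < ε} :=
    fun c i ↦ isOpen_lt (by fun_prop) continuous_const
  exact (key (ε * p.1) 0).inter (key (ε * p.2) 1)

/-- The points near a fixed grid point form an open set. If `p` and `q` were not joined, grid points
joined to `p` and the others would give two open sets covering `X`; at a common point of both,
nearby grid points are joined after all. -/
theorem IsPreconnected.gridJoined_gridNhd {ε : ℝ} (hε : 0 < ε)
    {X : Set (EuclideanSpace ℝ (Fin 2))} (hX : IsPreconnected X) {p q : ℤ × ℤ}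
    (hp : p ∈ gridNhd ε X) (hq : q ∈ gridNhd ε X) : GridJoined (gridNhd ε X) p q := by
  by_contra hcon
  obtain ⟨x, hx, hxp⟩ := hp
  obtain ⟨y, hy, hyq⟩ := hq
  obtain ⟨z, hz, h1, h2⟩ := hX
    (⋃ a ∈ {a | GridJoined (gridNhd ε X) p a}, {x | GridNear ε x a})
    (⋃ a ∈ {a | ¬GridJoined (gridNhd ε X) p a}, {x | GridNear ε x a})
    (isOpen_biUnion fun a _ ↦ isOpen_setOf_gridNear ε a)
    (isOpen_biUnion fun a _ ↦ isOpen_setOf_gridNear ε a)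
    (fun z _ ↦ by
      obtain ⟨a, ha⟩ := exists_gridNear hε z
      by_cases h : GridJoined (gridNhd ε X) p a
      · exact Or.inl (Set.mem_biUnion (Set.mem_ofPred.2 h) ha)
      · exact Or.inr (Set.mem_biUnion (Set.mem_ofPred.2 h) ha))
    ⟨x, hx, Set.mem_biUnion (Set.mem_ofPred.2 .refl) hxp⟩
    ⟨y, hy, Set.mem_biUnion (Set.mem_ofPred.2 hcon) hyq⟩
  obtain ⟨a, ha, haz⟩ := Set.mem_iUnion₂.1 h1
  obtain ⟨b, hb, hbz⟩ := Set.mem_iUnion₂.1 h2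
  exact hb (Relation.ReflTransGen.trans ha (gridJoined_gridNhd_of_near hε hz haz hbz))

theorem IsCompact.finite_gridNhd {ε : ℝ} (hε : 0 < ε) {X : Set (EuclideanSpace ℝ (Fin 2))}
    (hX : IsCompact X) : (gridNhd ε X).Finite := by
  obtain ⟨R, hR⟩ := hX.isBounded.exists_norm_le
  obtain ⟨N, hN⟩ := exists_int_gt ((R + ε) / ε)
  rw [div_lt_iff₀ hε] at hN
  refine ((Set.finite_Icc (-N) N).prod (Set.finite_Icc (-N) N)).subset ?_
  rintro ⟨p1, p2⟩ ⟨x, hx, h1, h2⟩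
  have key : ∀ {a : ℤ} {i : Fin 2}, |ε * a - x i| < ε → a ∈ Set.Icc (-N) N := by
    intro a i h
    have h3 : |x i| ≤ R := (PiLp.norm_apply_le x i).trans (hR x hx)
    rw [abs_lt] at h
    rw [abs_le] at h3
    have h4 : (a : ℝ) ≤ N := by nlinarith
    have h5 : (-N : ℝ) ≤ a := by nlinarith
    exact ⟨by exact_mod_cast h5, by exact_mod_cast h4⟩
  exact ⟨key h1, key h2⟩

theorem Disjoint.eventually_disjoint_gridNhd {X Y : Set (EuclideanSpace ℝ (Fin 2))}
    (h : Disjoint X Y) (hX : IsCompact X) (hY : IsCompact Y) :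
    ∀ᶠ ε in nhdsWithin (0 : ℝ) (Set.Ioi 0), Disjoint (gridNhd ε X) (gridNhd ε Y) := by
  obtain ⟨δ, hδ, hd⟩ := h.exists_thickenings hX hY.isClosed
  -- A common grid point forces distance at most 2√2 ε, which is below `δ` when ε < δ/4.
  have : Set.Ioo (0 : ℝ) (δ / 4) ∈ nhdsWithin (0 : ℝ) (Set.Ioi 0) :=
    Ioo_mem_nhdsGT (by positivity)
  filter_upwards [this] with ε hε
  rw [Set.disjoint_left]
  rintro p ⟨x, hx, hxp⟩ ⟨y, hy, hyp⟩
  have hdist : dist x y < δ := by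
    have h1 : |x 0 - y 0| ≤ 2 * ε := by
      have a := abs_lt.1 hxp.1
      have b := abs_lt.1 hyp.1
      rw [abs_le]; constructor <;> linarith
    have h2 : |x 1 - y 1| ≤ 2 * ε := by
      have a := abs_lt.1 hxp.2
      have b := abs_lt.1 hyp.2
      rw [abs_le]; constructor <;> linarith
    rw [EuclideanSpace.dist_eq, Fin.sum_univ_two, Real.sqrt_lt' hδ, Real.dist_eq, Real.dist_eq]
    have h0 := hε.1
    have h3 := hε.2
    have h4 := abs_nonneg (x 0 - y 0)
    have h5 := abs_nonneg (x 1 - y 1)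
    nlinarith
  exact Set.disjoint_left.1 hd (Metric.mem_thickening_iff.2 ⟨x, hx, by rwa [dist_comm]⟩)
    (Metric.self_subset_thickening hδ Y hy)

/-- A connected part of the grid that joins `A` to `B` contains a connected part that touches `A`,
avoids `B` and is adjacent to `B`. -/
theorem exists_gridJoined_part {X A B : Set (ℤ × ℤ)} {a b : ℤ × ℤ} (hX : GridJoined X a b)
    (haX : a ∈ X) (ha : a ∈ A) (hb : b ∈ B) (hAB : Disjoint A B) :
    ∃ R ⊆ X, Disjoint R B ∧ (∃ a ∈ R, a ∈ A ∧ ∀ r ∈ R, GridJoined R a r) ∧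
      ∃ p ∈ R, ∃ q ∈ B, GridAdj p q := by
  have haB : a ∉ B := Set.disjoint_left.1 hAB ha
  -- Everything reachable from `a` before entering `B`. If no point of it were adjacent to `B`, the
  -- path to `b` could never enter `B`.
  let R : Set (ℤ × ℤ) := {r | GridJoined (X \ B) a r}
  have hR : R ⊆ X \ B := by
    intro r hr
    rcases Relation.ReflTransGen.cases_tail hr with rfl | ⟨c, _, hc⟩
    · exact ⟨haX, haB⟩
    · exact hc.2.2
  refine ⟨R, fun r hr ↦ (hR hr).1, Set.disjoint_left.2 fun r hr ↦ (hR hr).2,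
    ⟨a, .refl, ha, fun r hr ↦ ?_⟩, ?_⟩
  · have : ∀ r, GridJoined (X \ B) a r → GridJoined R a r := by
      intro r hr
      induction hr with
      | refl => exact .refl
      | tail h1 h2 ih => exact ih.tail ⟨h2.1, h1, h1.tail h2⟩
    exact this r hr
  · by_contra! hcon
    have : ∀ r, GridJoined X a r → r ∈ R := by
      intro r hr
      induction hr with
      | refl => exact .refl
      | @tail c d h1 h2 ih =>
        have hd : d ∉ B := fun hd ↦ hcon c ih d hd h2.1
        exact Relation.ReflTransGen.tail ih ⟨h2.1, hR ih, h2.2.2, hd⟩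
    exact (hR (this b hX)).2 hb

/-! ### From a plane drawing to a grid model -/

namespace SimpleGraph.PlaneEmbedding

open Set

variable {V : Type u} {G : SimpleGraph V} (P : G.PlaneEmbedding)

/-- Cutting edges into thirds gives compact connected pieces: stars at distinct vertices are
disjoint, and a middle third meets only the stars at its two ends. A fine grid preserves these
disjointness relations. -/
noncomputable def oneThird : unitInterval := ⟨1 / 3, by norm_num, by norm_num⟩

noncomputable def twoThirds : unitInterval := ⟨2 / 3, by norm_num, by norm_num⟩

theorem oneThird_lt_twoThirds : oneThird < twoThirds := by
  rw [← Subtype.coe_lt_coe]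
  norm_num [oneThird, twoThirds]

theorem oneThird_pos : 0 < oneThird := by
  rw [← Subtype.coe_lt_coe]
  norm_num [oneThird]

theorem twoThirds_lt_one : twoThirds < 1 := by
  rw [← Subtype.coe_lt_coe]
  norm_num [twoThirds]

/-- The parameter `t` lies in the third of the edge `e` at the vertex `v`. -/
def EndThird (e : G.edgeSet) (t : unitInterval) (v : V) : Prop :=
  t ≤ oneThird ∧ P.curve e 0 = P.point v ∨ twoThirds ≤ t ∧ P.curve e 1 = P.point v

/-- A vertex together with the adjacent thirds of its edges. -/
def star (v : V) : Set (EuclideanSpace ℝ (Fin 2)) :=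
  {P.point v} ∪ ((⋃ (e : G.edgeSet) (_ : P.curve e 0 = P.point v), P.curve e '' Iic oneThird) ∪
    ⋃ (e : G.edgeSet) (_ : P.curve e 1 = P.point v), P.curve e '' Ici twoThirds)

/-- The middle third of an edge. -/
def middle (e : G.edgeSet) : Set (EuclideanSpace ℝ (Fin 2)) :=
  P.curve e '' Icc oneThird twoThirds

theorem mem_star {v : V} {x : EuclideanSpace ℝ (Fin 2)} :
    x ∈ P.star v ↔ x = P.point v ∨ ∃ e t, P.EndThird e t v ∧ P.curve e t = x := by
  simp only [star, mem_union, mem_singleton_iff, mem_iUnion, mem_image, mem_Iic, mem_Ici,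
    exists_prop, EndThird]
  constructor
  · rintro (h | ⟨e, h, t, ht, hx⟩ | ⟨e, h, t, ht, hx⟩)
    · exact Or.inl h
    · exact Or.inr ⟨e, t, Or.inl ⟨ht, h⟩, hx⟩
    · exact Or.inr ⟨e, t, Or.inr ⟨ht, h⟩, hx⟩
  · rintro (h | ⟨e, t, ⟨ht, h⟩ | ⟨ht, h⟩, hx⟩)
    · exact Or.inl h
    · exact Or.inr (Or.inl ⟨e, h, t, ht, hx⟩)
    · exact Or.inr (Or.inr ⟨e, h, t, ht, hx⟩)

theorem isCompact_star [Finite V] (v : V) : IsCompact (P.star v) := by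
  refine isCompact_singleton.union (IsCompact.union ?_ ?_)
  · exact isCompact_iUnion fun e ↦ isCompact_iUnion fun _ ↦
      isClosed_Iic.isCompact.image (P.curve e).continuous
  · exact isCompact_iUnion fun e ↦ isCompact_iUnion fun _ ↦
      isClosed_Ici.isCompact.image (P.curve e).continuous

theorem isCompact_middle (e : G.edgeSet) : IsCompact (P.middle e) :=
  isClosed_Icc.isCompact.image (P.curve e).continuous

theorem isPreconnected_middle (e : G.edgeSet) : IsPreconnected (P.middle e) :=
  ordConnected_Icc.isPreconnected.image _ (P.curve e).continuous.continuousOn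

theorem isPreconnected_star (v : V) : IsPreconnected (P.star v) := by
  refine isPreconnected_of_forall (P.point v) fun y hy ↦ ?_
  obtain rfl | ⟨e, t, ⟨ht, h⟩ | ⟨ht, h⟩, rfl⟩ := P.mem_star.1 hy
  · exact ⟨{P.point v}, singleton_subset_iff.2 hy, rfl, rfl, isPreconnected_singleton⟩
  · refine ⟨P.curve e '' Iic oneThird, ?_, ⟨0, oneThird_pos.le, h⟩, ⟨t, ht, rfl⟩,
      ordConnected_Iic.isPreconnected.image _ (P.curve e).continuous.continuousOn⟩
    rintro _ ⟨s, hs, rfl⟩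
    exact P.mem_star.2 (Or.inr ⟨e, s, Or.inl ⟨hs, h⟩, rfl⟩)
  · refine ⟨P.curve e '' Ici twoThirds, ?_, ⟨1, twoThirds_lt_one.le, h⟩, ⟨t, ht, rfl⟩,
      ordConnected_Ici.isPreconnected.image _ (P.curve e).continuous.continuousOn⟩
    rintro _ ⟨s, hs, rfl⟩
    exact P.mem_star.2 (Or.inr ⟨e, s, Or.inr ⟨hs, h⟩, rfl⟩)

variable {P}

theorem EndThird.curve_eq {e : G.edgeSet} {t : unitInterval} {v : V} (h : P.EndThird e t v)
    (ht : t = 0 ∨ t = 1) : P.curve e t = P.point v := by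
  rcases ht with rfl | rfl <;> rcases h with ⟨h, h'⟩ | ⟨h, h'⟩
  · exact h'
  · exact absurd (oneThird_pos.trans oneThird_lt_twoThirds) h.not_gt
  · exact absurd (oneThird_lt_twoThirds.trans twoThirds_lt_one) h.not_gt
  · exact h'

theorem EndThird.unique {e : G.edgeSet} {t : unitInterval} {v w : V} (h : P.EndThird e t v)
    (h' : P.EndThird e t w) : v = w := by
  apply P.point_injective
  rcases h with ⟨h1, h2⟩ | ⟨h1, h2⟩ <;> rcases h' with ⟨h3, h4⟩ | ⟨h3, h4⟩
  · exact h2.symm.trans h4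
  · exact absurd (h3.trans h1) oneThird_lt_twoThirds.not_ge
  · exact absurd (h1.trans h3) oneThird_lt_twoThirds.not_ge
  · exact h2.symm.trans h4

theorem EndThird.mem {e : G.edgeSet} {t : unitInterval} {v : V} (h : P.EndThird e t v) :
    v ∈ (e : Sym2 V) := by
  have h1 : P.point v ∈ Sym2.map P.point (e : Sym2 V) := by
    rw [← P.curve_ends e, Sym2.mem_iff]
    rcases h with ⟨_, h⟩ | ⟨_, h⟩
    · exact Or.inl h.symm
    · exact Or.inr h.symm
  obtain ⟨w, hw, hwv⟩ := Sym2.mem_map.1 h1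
  exact P.point_injective hwv ▸ hw

variable (P)

/-- Distinct curves meet only at parameters 0 and 1, and an end third belonging to `v` can have such
a parameter only at the point of `v` itself. -/
theorem disjoint_star {v w : V} (hvw : v ≠ w) : Disjoint (P.star v) (P.star w) := by
  rw [Set.disjoint_left]
  intro x hv hw
  obtain rfl | ⟨e, t, h, rfl⟩ := P.mem_star.1 hv <;>
    obtain h' | ⟨e', t', h', h''⟩ := P.mem_star.1 hw
  · exact hvw (P.point_injective h')
  · have := h'.curve_eq (P.vertex_not_interior _ _ _ h'')
    exact hvw (P.point_injective (h''.symm.trans this))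
  · have := h.curve_eq (P.vertex_not_interior _ _ _ h')
    exact hvw (P.point_injective (this.symm.trans h'))
  · by_cases he : e = e'
    · subst he
      obtain rfl := P.curve_injective _ h''
      exact hvw (h.unique h')
    · have h1 := h.curve_eq (P.curves_meet_at_ends _ _ he _ _ h''.symm)
      have h2 := h'.curve_eq (P.curves_meet_at_ends _ _ (Ne.symm he) _ _ h'')
      exact hvw (P.point_injective (h1.symm.trans (h''.symm.trans h2)))

theorem ne_of_mem_middle {t : unitInterval} (ht : t ∈ Icc oneThird twoThirds) :
    ¬(t = 0 ∨ t = 1) := by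
  rintro (rfl | rfl)
  · exact oneThird_pos.not_ge ht.1
  · exact twoThirds_lt_one.not_ge ht.2

theorem disjoint_middle {e e' : G.edgeSet} (he : e ≠ e') :
    Disjoint (P.middle e) (P.middle e') := by
  rw [Set.disjoint_left]
  rintro _ ⟨t, ht, rfl⟩ ⟨t', _, h⟩
  exact ne_of_mem_middle ht (P.curves_meet_at_ends _ _ he _ _ h.symm)

theorem disjoint_middle_star {e : G.edgeSet} {v : V} (hv : v ∉ (e : Sym2 V)) :
    Disjoint (P.middle e) (P.star v) := by
  rw [Set.disjoint_left]
  rintro _ ⟨t, ht, rfl⟩ h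
  obtain h' | ⟨e', t', h', h''⟩ := P.mem_star.1 h
  · exact ne_of_mem_middle ht (P.vertex_not_interior _ _ _ h')
  · have he : e ≠ e' := by
      rintro rfl
      exact hv h'.mem
    exact ne_of_mem_middle ht (P.curves_meet_at_ends _ _ he _ _ h''.symm)

theorem nonempty_middle_inter_star {e : G.edgeSet} {v : V} (hv : v ∈ (e : Sym2 V)) :
    (P.middle e ∩ P.star v).Nonempty := by
  have h1 : P.point v ∈ Sym2.map P.point (e : Sym2 V) := Sym2.mem_map.2 ⟨v, hv, rfl⟩
  rw [← P.curve_ends e, Sym2.mem_iff] at h1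
  rcases h1 with h1 | h1
  · exact ⟨P.curve e oneThird, ⟨_, ⟨le_rfl, oneThird_lt_twoThirds.le⟩, rfl⟩,
      P.mem_star.2 (Or.inr ⟨e, _, Or.inl ⟨le_rfl, h1.symm⟩, rfl⟩)⟩
  · exact ⟨P.curve e twoThirds, ⟨_, ⟨oneThird_lt_twoThirds.le, le_rfl⟩, rfl⟩,
      P.mem_star.2 (Or.inr ⟨e, _, Or.inr ⟨le_rfl, h1.symm⟩, rfl⟩)⟩

/-- A graph embedded in the plane is a minor of the square grid. -/
theorem nonempty_gridModel [Finite V] (P : G.PlaneEmbedding) : Nonempty (GridModel G) := by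
  classical
  -- a mesh that separates disjoint pieces
  obtain ⟨ε, hε, hss, hmm, hms⟩ : ∃ ε : ℝ, 0 < ε ∧
      (∀ v w, v ≠ w → Disjoint (gridNhd ε (P.star v)) (gridNhd ε (P.star w))) ∧
      (∀ e e', e ≠ e' → Disjoint (gridNhd ε (P.middle e)) (gridNhd ε (P.middle e'))) ∧
      ∀ (e : G.edgeSet) v, v ∉ (e : Sym2 V) →
        Disjoint (gridNhd ε (P.middle e)) (gridNhd ε (P.star v)) := by
    refine Filter.Eventually.exists (f := nhdsWithin (0 : ℝ) (Ioi 0)) ?_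
    refine Filter.Eventually.and (eventually_mem_nhdsWithin) (Filter.Eventually.and ?_ (Filter.Eventually.and ?_ ?_))
    · simp only [Filter.eventually_all]
      exact fun v w h ↦ (P.disjoint_star h).eventually_disjoint_gridNhd (P.isCompact_star v)
        (P.isCompact_star w)
    · simp only [Filter.eventually_all]
      exact fun e e' h ↦ (P.disjoint_middle h).eventually_disjoint_gridNhd (P.isCompact_middle e)
        (P.isCompact_middle e')
    · simp only [Filter.eventually_all]
      exact fun e v h ↦ (P.disjoint_middle_star h).eventually_disjoint_gridNhd
        (P.isCompact_middle e) (P.isCompact_star v)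
  -- one end of each edge absorbs most of the middle third
  have htail : ∀ e : G.edgeSet, ∃ v w : V, (e : Sym2 V) = s(v, w) := fun e ↦ by
    obtain ⟨e, he⟩ := e
    induction e with
    | _ v w => exact ⟨v, w, rfl⟩
  choose tail head hth using htail
  have hne : ∀ e, tail e ≠ head e := fun e h ↦ by
    have := e.2
    rw [hth e, mem_edgeSet] at this
    exact this.ne h
  have hmeet : ∀ (e : G.edgeSet) v, v ∈ (e : Sym2 V) →
      ∃ p, p ∈ gridNhd ε (P.middle e) ∧ p ∈ gridNhd ε (P.star v) := by
    intro e v hv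
    obtain ⟨x, hx, hx'⟩ := P.nonempty_middle_inter_star hv
    obtain ⟨p, hp⟩ := exists_gridNear hε x
    exact ⟨p, ⟨x, hx, hp⟩, ⟨x, hx', hp⟩⟩
  have hpart : ∀ e, ∃ R ⊆ gridNhd ε (P.middle e), Disjoint R (gridNhd ε (P.star (head e))) ∧
      (∃ a ∈ R, a ∈ gridNhd ε (P.star (tail e)) ∧ ∀ r ∈ R, GridJoined R a r) ∧
      ∃ p ∈ R, ∃ q ∈ gridNhd ε (P.star (head e)), GridAdj p q := by
    intro e
    obtain ⟨a, ha, ha'⟩ := hmeet e (tail e) (by rw [hth e]; exact Sym2.mem_mk_left _ _)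
    obtain ⟨b, hb, hb'⟩ := hmeet e (head e) (by rw [hth e]; exact Sym2.mem_mk_right _ _)
    exact exists_gridJoined_part ((P.isPreconnected_middle e).gridJoined_gridNhd hε ha hb) ha ha' hb'
      (hss _ _ (hne e))
  choose R hRX hRB hRA hRp using hpart
  -- The branch set of `v` is the neighbourhood of its star with the parts `R e` of all edges having
  -- tail `v`. Each `R e` stops one grid step before the star of the head.
  let B : V → Set (ℤ × ℤ) := fun v ↦
    gridNhd ε (P.star v) ∪ ⋃ (e : G.edgeSet) (_ : tail e = v), R e
  have hBfin : ∀ v, (B v).Finite := fun v ↦ ((P.isCompact_star v).finite_gridNhd hε).union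
    (finite_iUnion fun e ↦ finite_iUnion fun _ ↦
      ((P.isCompact_middle e).finite_gridNhd hε).subset (hRX e))
  have hsub : ∀ v, gridNhd ε (P.star v) ⊆ B v := fun v ↦ subset_union_left
  have hRsub : ∀ e, R e ⊆ B (tail e) := fun e x hx ↦
    Or.inr (mem_iUnion₂.2 ⟨e, rfl, hx⟩)
  have hRdisj : ∀ e v, tail e ≠ v → Disjoint (R e) (gridNhd ε (P.star v)) := by
    intro e v hv
    by_cases h : head e = v
    · exact h ▸ hRB e
    · refine (hms e v ?_).mono_left (hRX e)
      rw [hth e, Sym2.mem_iff]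
      rintro (rfl | rfl)
      · exact hv rfl
      · exact h rfl
  have hBdisj : ∀ v w p, p ∈ B v → p ∈ B w → v = w := by
    intro v w p hv hw
    by_contra hvw
    rcases hv with hv | hv <;> rcases hw with hw | hw
    · exact Set.disjoint_left.1 (hss v w hvw) hv hw
    · obtain ⟨e, rfl, he⟩ := mem_iUnion₂.1 hw
      exact Set.disjoint_left.1 (hRdisj e v (Ne.symm hvw)) he hv
    · obtain ⟨e, rfl, he⟩ := mem_iUnion₂.1 hv
      exact Set.disjoint_left.1 (hRdisj e w hvw) he hw
    · obtain ⟨e, rfl, he⟩ := mem_iUnion₂.1 hv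
      obtain ⟨e', rfl, he'⟩ := mem_iUnion₂.1 hw
      refine Set.disjoint_left.1 (hmm e e' ?_) (hRX e he) (hRX e' he')
      rintro rfl
      exact hvw rfl
  have hcenter : ∀ v, ∀ p ∈ B v, ∃ q ∈ gridNhd ε (P.star v), GridJoined (B v) q p := by
    rintro v p (hp | hp)
    · exact ⟨p, hp, .refl⟩
    · obtain ⟨e, rfl, he⟩ := mem_iUnion₂.1 hp
      obtain ⟨a, _, ha, hr⟩ := hRA e
      exact ⟨a, ha, (hr p he).mono (hRsub e)⟩
  have hBconn : ∀ v, ∀ p ∈ B v, ∀ q ∈ B v, GridJoined (B v) p q := by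
    intro v p hp q hq
    obtain ⟨p', hp', hpp⟩ := hcenter v p hp
    obtain ⟨q', hq', hqq⟩ := hcenter v q hq
    have := ((P.isPreconnected_star v).gridJoined_gridNhd hε hp' hq').mono (hsub v)
    exact hpp.symm.trans (this.trans hqq)
  choose p hpR q hq hpq using hRp
  have hport : ∀ v w (h : G.Adj v w), tail ⟨s(v, w), h⟩ = v ∧ head ⟨s(v, w), h⟩ = w ∨
      tail ⟨s(v, w), h⟩ = w ∧ head ⟨s(v, w), h⟩ = v := by
    intro v w h
    have := hth ⟨s(v, w), h⟩
    rw [Sym2.eq_iff] at this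
    rcases this with h | h
    · exact Or.inl ⟨h.1.symm, h.2.symm⟩
    · exact Or.inr ⟨h.2.symm, h.1.symm⟩
  -- The tail's port `p` is the last point of `R e`, the head's port `q` lies in the star next to
  -- it; 0 is a dummy for non-adjacent pairs.
  let port : V → V → ℤ × ℤ := fun v w ↦
    if h : G.Adj v w then if tail ⟨s(v, w), h⟩ = v then p ⟨s(v, w), h⟩ else q ⟨s(v, w), h⟩ else 0
  refine ⟨⟨fun v ↦ (hBfin v).toFinset, ?_, ?_, port, ?_, ?_⟩⟩
  · simpa using hBconn
  · simpa using hBdisj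
  · intro v w h
    simp only [Finite.mem_toFinset, port, dif_pos h]
    rcases hport v w h with ⟨h1, h2⟩ | ⟨h1, h2⟩
    · rw [if_pos h1]
      have := hRsub _ (hpR ⟨s(v, w), h⟩)
      rwa [h1] at this
    · rw [if_neg (by rw [h1]; exact h.ne')]
      have := hsub _ (hq ⟨s(v, w), h⟩)
      rwa [h2] at this
  · intro v w h
    have hsw : (⟨s(w, v), h.symm⟩ : G.edgeSet) = ⟨s(v, w), h⟩ := Subtype.ext Sym2.eq_swap
    simp only [port, dif_pos h, dif_pos h.symm, hsw]
    rcases hport v w h with ⟨h1, h2⟩ | ⟨h1, h2⟩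
    · rw [if_pos h1, if_neg (by rw [h1]; exact h.ne)]
      exact hpq _
    · rw [if_neg (by rw [h1]; exact h.ne'), if_pos h1]
      exact (hpq _).symm

end SimpleGraph.PlaneEmbedding

/-- A model of a graph restricts to its subgraphs. -/
def GridModel.restrict {V : Type u} {G H : SimpleGraph V} (M : GridModel G) (h : H ≤ G) :
    GridModel H where
  branch := M.branch
  joined := M.joined
  disjoint := M.disjoint
  port := M.port
  port_mem v w hvw := M.port_mem v w (h hvw)
  port_adj v w hvw := M.port_adj v w (h hvw)

/-! ### List colouring with conflicts -/

/-- A conflict relation for colourings: colour `a` at `x` excludes at most one colour at each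
neighbour `y` of `x`. -/
structure ConflictSystem (X : Type u) (A : Type w) where
  Nbr : X → X → Prop
  nbr_ne : ∀ {x y}, Nbr x y → x ≠ y
  nbr_symm : ∀ {x y}, Nbr x y → Nbr y x
  Bad : X → X → A → A → Prop
  bad_nbr : ∀ {x y a b}, Bad x y a b → Nbr x y
  bad_symm : ∀ {x y a b}, Bad x y a b → Bad y x b a
  bad_unique : ∀ {x y a b b'}, Bad x y a b → Bad x y a b' → b = b'

namespace ConflictSystem

open Finset

open scoped Classical in
section

variable {X : Type u} {A : Type w} (C : ConflictSystem X A)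

/-- `c` colours `S` from the lists `L` without conflicts. -/
def IsColoring (L : X → Finset A) (S : Finset X) (c : X → A) : Prop :=
  (∀ x ∈ S, c x ∈ L x) ∧ ∀ x ∈ S, ∀ y ∈ S, ¬C.Bad x y (c x) (c y)

variable {C}

/-- Each coloured neighbour of `x` removes at most one colour from `Y`. -/
theorem card_le_card_filter_add (Y : Finset A) (T : Finset X) (c : X → A) (x : X) :
    #Y ≤ #{a ∈ Y | ∀ y ∈ T, ¬C.Bad y x (c y) a} + #{y ∈ T | C.Nbr x y} := by
  rw [← card_filter_add_card_filter_not (s := Y) fun a ↦ ∀ y ∈ T, ¬C.Bad y x (c y) a]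
  refine Nat.add_le_add_left ?_ _
  calc _ ≤ #({y ∈ T | C.Nbr x y}.biUnion fun y ↦ {a ∈ Y | C.Bad y x (c y) a}) := by
        refine card_le_card fun a ha ↦ ?_
        simp only [mem_filter, not_forall, not_not] at ha
        obtain ⟨haY, y, hy, hbad⟩ := ha
        exact mem_biUnion.2 ⟨y, mem_filter.2 ⟨hy, C.nbr_symm (C.bad_nbr hbad)⟩,
          mem_filter.2 ⟨haY, hbad⟩⟩
    _ ≤ #{y ∈ T | C.Nbr x y} * 1 := by
        refine card_biUnion_le_card_mul _ _ _ fun y _ ↦ card_le_one.2 fun a ha b hb ↦ ?_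
        exact C.bad_unique (mem_filter.1 ha).2 (mem_filter.1 hb).2
    _ = _ := mul_one _

variable [DecidableEq X]

theorem IsColoring.insert_update {L : X → Finset A} {S : Finset X} {c : X → A} (hc : C.IsColoring L S c)
    {x : X} (hx : x ∉ S) {a : A} (ha : a ∈ L x) (hbad : ∀ y ∈ S, ¬C.Bad y x (c y) a) :
    C.IsColoring L (insert x S) (Function.update c x a) := by
  have hne : ∀ y ∈ S, Function.update c x a y = c y := fun y hy ↦
    Function.update_of_ne (by rintro rfl; exact hx hy) _ _
  refine ⟨fun y hy ↦ ?_, fun y hy z hz ↦ ?_⟩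
  · rcases mem_insert.1 hy with rfl | hy
    · rwa [Function.update_self]
    · rw [hne y hy]
      exact hc.1 y hy
  · rcases mem_insert.1 hy with rfl | hy' <;> rcases mem_insert.1 hz with rfl | hz'
    · exact fun h ↦ C.nbr_ne (C.bad_nbr h) rfl
    · rw [Function.update_self, hne z hz']
      exact fun h ↦ hbad z hz' (C.bad_symm h)
    · rw [Function.update_self, hne y hy']
      exact hbad y hy'
    · rw [hne y hy', hne z hz']
      exact hc.2 y hy' z hz'

theorem IsColoring.exists_insert_update {L : X → Finset A} {S : Finset X} {c : X → A}
    (hc : C.IsColoring L S c) {x : X} (hx : x ∉ S) {Y : Finset A} (hY : Y ⊆ L x)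
    (hcard : #{y ∈ S | C.Nbr x y} < #Y) :
    ∃ a ∈ Y, C.IsColoring L (insert x S) (Function.update c x a) := by
  have h := C.card_le_card_filter_add Y S c x
  obtain ⟨a, ha⟩ : ({a ∈ Y | ∀ y ∈ S, ¬C.Bad y x (c y) a} : Finset A).Nonempty :=
    card_pos.1 (by omega)
  rw [mem_filter] at ha
  exact ⟨a, ha.1, hc.insert_update hx (hY ha.1) ha.2⟩

/-- Greedy colouring along a path: each vertex has its successor as an uncoloured neighbour. -/
theorem IsColoring.exists_extend_path {L : X → Finset A} {S T : Finset X} {c : X → A}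
    (hc : C.IsColoring L T c) (hTS : T ⊆ S) (hdeg : ∀ z ∈ S, #{y ∈ S | C.Nbr z y} ≤ #(L z))
    {e : ℕ → X} {m : ℕ} (heS : ∀ i ≤ m, e i ∈ S) (heT : ∀ i ≤ m, e i ∉ T)
    (hinj : ∀ i ≤ m, ∀ j ≤ m, e i = e j → i = j) (hnbr : ∀ i < m, C.Nbr (e i) (e (i + 1))) :
    ∀ i ≤ m, ∃ c', C.IsColoring L (T ∪ (range i).image e) c' ∧ ∀ t ∈ T, c' t = c t := by
  intro i
  induction i with
  | zero => exact fun _ ↦ ⟨c, by simpa using hc, fun _ _ ↦ rfl⟩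
  | succ i ih =>
    intro hi
    obtain ⟨c', hc', hcc⟩ := ih (by omega)
    have hnew : ∀ j, i ≤ j → j ≤ m → e j ∉ T ∪ (range i).image e := by
      intro j hij hj hmem
      rcases mem_union.1 hmem with h | h
      · exact heT j hj h
      · obtain ⟨l, hl, hlj⟩ := mem_image.1 h
        rw [mem_range] at hl
        have := hinj l (by omega) j hj hlj
        omega
    have hsub : T ∪ (range i).image e ⊆ S := by
      refine union_subset hTS (image_subset_iff.2 fun l hl ↦ heS l ?_)
      rw [mem_range] at hl
      omega
    -- The successor `e (i + 1)` is a neighbour still uncoloured, so the coloured neighbours number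
    -- strictly fewer than the list.
    have hcard : #{y ∈ T ∪ (range i).image e | C.Nbr (e i) y} < #(L (e i)) := by
      refine lt_of_lt_of_le (card_lt_card ?_) (hdeg _ (heS i (by omega)))
      refine (ssubset_iff_of_subset (filter_subset_filter _ hsub)).2 ⟨e (i + 1), ?_, ?_⟩
      · exact mem_filter.2 ⟨heS _ hi, hnbr i (by omega)⟩
      · exact fun h ↦ hnew (i + 1) (by omega) hi (mem_filter.1 h).1
    obtain ⟨a, _, ha⟩ := hc'.exists_insert_update (hnew i le_rfl (by omega)) Subset.rfl hcard
    refine ⟨Function.update c' (e i) a, ?_, fun t ht ↦ ?_⟩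
    · rw [range_add_one, image_insert, union_insert]
      exact ha
    · rw [Function.update_of_ne (by rintro rfl; exact heT i (by omega) ht), hcc t ht]

/-- A colouring of `T` extends to a further vertex `x` and a path that ends at a neighbour of `x`
with fewer available colours than `x`. -/
theorem IsColoring.exists_extend {L : X → Finset A} {S T : Finset X} {c : X → A}
    (hc : C.IsColoring L T c) (hdeg : ∀ z ∈ S, #{y ∈ S | C.Nbr z y} ≤ #(L z))
    {e : ℕ → X} {m n : ℕ} {x : X} (hS : S = insert x T ∪ (range (m + 1)).image e) (hxT : x ∉ T)
    (heT : ∀ i ≤ m, e i ∉ insert x T) (hinj : ∀ i ≤ m, ∀ j ≤ m, e i = e j → i = j)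
    (hnbr : ∀ i < m, C.Nbr (e i) (e (i + 1)))
    (hn : #{y ∈ (range m).image e | C.Nbr (e m) y} < n)
    (hnT : n + #{y ∈ T | C.Nbr (e m) y} ≤ #(L (e m)))
    (hnx : n + #{y ∈ T | C.Nbr x y} < #(L x)) : ∃ c', C.IsColoring L S c' := by
  have h1 := C.card_le_card_filter_add (L (e m)) T c (e m)
  have h2 := C.card_le_card_filter_add (L x) T c x
  obtain ⟨Y, hY, hYn⟩ := exists_subset_card_eq
    (show n ≤ #{a ∈ L (e m) | ∀ y ∈ T, ¬C.Bad y (e m) (c y) a} by omega)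
  -- a colour of `x` without effect on `Y`
  obtain ⟨a, ha, haY⟩ : ∃ a ∈ ({a ∈ L x | ∀ y ∈ T, ¬C.Bad y x (c y) a} : Finset A),
      ∀ b ∈ Y, ¬C.Bad x (e m) a b := by
    -- If every available colour of `x` conflicted with some colour in `Y`, choosing one would be
    -- injective, because a colour at `e m` excludes at most one at `x`. But `x` has more than `n`
    -- available colours and `Y` has `n`.
    by_contra! hcon
    have : #{a ∈ L x | ∀ y ∈ T, ¬C.Bad y x (c y) a} ≤ #Y := by
      choose! b hb hbad using hcon
      refine card_le_card_of_injOn b hb fun a ha a' ha' haa ↦ ?_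
      have h3 := C.bad_symm (hbad a ha)
      have h4 := C.bad_symm (hbad a' ha')
      rw [haa] at h3
      exact C.bad_unique h3 h4
    omega
  rw [mem_filter] at ha
  have hcx := hc.insert_update hxT ha.1 ha.2
  obtain ⟨c', hc', hcc⟩ := hcx.exists_extend_path (hS ▸ subset_union_left) hdeg
    (fun i hi ↦ hS ▸ mem_union_right _ (mem_image_of_mem _ (mem_range.2 (by omega))))
    heT hinj hnbr m le_rfl
  have hem : e m ∉ insert x T ∪ (range m).image e := by
    intro hmem
    rcases mem_union.1 hmem with h | h
    · exact heT m le_rfl h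
    · obtain ⟨l, hl, hlj⟩ := mem_image.1 h
      rw [mem_range] at hl
      have := hinj l (by omega) m le_rfl hlj
      omega
  have h3 := C.card_le_card_filter_add Y ((range m).image e) c' (e m)
  -- `Y` already avoids `T` and `x`, so only the fewer than `n` neighbours on the path can remove
  -- colours from it.
  obtain ⟨b, hb⟩ : ({b ∈ Y | ∀ y ∈ (range m).image e, ¬C.Bad y (e m) (c' y) b} :
      Finset A).Nonempty := card_pos.1 (by omega)
  rw [mem_filter] at hb
  have hbL := mem_filter.1 (hY hb.1)
  refine ⟨Function.update c' (e m) b, ?_⟩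
  rw [hS, range_add_one, image_insert, union_insert]
  refine hc'.insert_update hem hbL.1 fun y hy ↦ ?_
  rcases mem_union.1 hy with hy' | hy'
  · rw [hcc y hy']
    rcases mem_insert.1 hy' with rfl | hyT
    · rw [Function.update_self]
      exact haY b hb.1
    · rw [Function.update_of_ne (by rintro rfl; exact hxT hyT)]
      exact hbL.2 y hyT
  · exact hb.2 y hy'

end

end ConflictSystem

/-! ### Colouring the edges of a graph -/

namespace EdgeColoring

open Finset

open scoped Classical in
section

variable {V : Type u} {A : Type w}

/-- The number of edges of `S` at the vertex `v`. -/
noncomputable def edgeDeg (S : Finset (Sym2 V)) (v : V) : ℕ := #{e ∈ S | v ∈ e}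

/-- Neighbours are edges with a common end. -/
def IsEdgeSystem (C : ConflictSystem (Sym2 V) A) : Prop :=
  ∀ e e', C.Nbr e e' ↔ e ≠ e' ∧ ∃ v, v ∈ e ∧ v ∈ e'

variable {C : ConflictSystem (Sym2 V) A}

/-- The edge itself is counted in both degrees, which accounts for the 2. -/
theorem IsEdgeSystem.card_nbr_add_two_le (hC : IsEdgeSystem C) {S : Finset (Sym2 V)} {u v : V}
    (he : s(u, v) ∈ S) : #{e ∈ S | C.Nbr s(u, v) e} + 2 ≤ edgeDeg S u + edgeDeg S v := by
  have hu : s(u, v) ∈ ({e ∈ S | u ∈ e} : Finset (Sym2 V)) := by simp [he]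
  have hv : s(u, v) ∈ ({e ∈ S | v ∈ e} : Finset (Sym2 V)) := by simp [he]
  have h1 := card_erase_add_one hu
  have h2 := card_erase_add_one hv
  have h3 : #{e ∈ S | C.Nbr s(u, v) e} ≤
      #(({e ∈ S | u ∈ e} : Finset (Sym2 V)).erase s(u, v) ∪
        ({e ∈ S | v ∈ e} : Finset (Sym2 V)).erase s(u, v)) := by
    refine card_le_card fun e hmem ↦ ?_
    obtain ⟨heS, hN⟩ := mem_filter.1 hmem
    obtain ⟨hne, w, hw, hwe⟩ := (hC _ _).1 hN
    rw [mem_union, mem_erase, mem_erase, mem_filter, mem_filter]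
    rcases Sym2.mem_iff.1 hw with rfl | rfl
    · exact Or.inl ⟨hne.symm, heS, hwe⟩
    · exact Or.inr ⟨hne.symm, heS, hwe⟩
  have h4 := h3.trans (card_union_le _ _)
  unfold edgeDeg
  omega

/-- If every edge of `S` has degrees at least `3` at both ends and degree sum at least `7`, then
the average degree of `S` is more than `10 / 3`. -/
theorem twelve_mul_card_le [Fintype V] {S : Finset (Sym2 V)}
    (hdiag : ∀ e ∈ S, ¬e.IsDiag) (h3 : ∀ e ∈ S, ∀ v ∈ e, 3 ≤ edgeDeg S v)
    (h7 : ∀ u v, s(u, v) ∈ S → 7 ≤ edgeDeg S u + edgeDeg S v) :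
    12 * #{v | edgeDeg S v ≠ 0} ≤ 7 * #S := by
  -- Discharging: each vertex of positive degree splits a unit charge equally among its edges, and
  -- an edge receives at most 1/3 + 1/4 = 7/12.
  have h1 : (#{v | edgeDeg S v ≠ 0} : ℚ)
      = ∑ e ∈ S, ∑ v, if v ∈ e then (1 / edgeDeg S v : ℚ) else 0 := by
    rw [sum_comm, card_filter, Nat.cast_sum]
    refine sum_congr rfl fun v _ ↦ ?_
    rw [← sum_filter, sum_const, nsmul_eq_mul]
    change _ = (edgeDeg S v : ℚ) * _
    by_cases h : edgeDeg S v = 0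
    · simp [h]
    · have : (edgeDeg S v : ℚ) ≠ 0 := by exact_mod_cast h
      simp [h]
  have h2 : ∀ e ∈ S, (∑ v, if v ∈ e then (1 / edgeDeg S v : ℚ) else 0) ≤ 7 / 12 := by
    intro e he
    induction e with
    | _ a b =>
      have hab : a ≠ b := hdiag _ he
      rw [← sum_filter]
      have : (univ.filter fun v ↦ v ∈ s(a, b)) = {a, b} := by
        ext v
        simp
      rw [this, sum_pair hab]
      have key : ∀ m n : ℕ, 3 ≤ m → 4 ≤ n → (1 / m + 1 / n : ℚ) ≤ 7 / 12 := by
        intro m n hm hn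
        have hm' : (3 : ℚ) ≤ m := by exact_mod_cast hm
        have hn' : (4 : ℚ) ≤ n := by exact_mod_cast hn
        have h5 : (1 / m : ℚ) ≤ 1 / 3 := one_div_le_one_div_of_le (by norm_num) hm'
        have h6 : (1 / n : ℚ) ≤ 1 / 4 := one_div_le_one_div_of_le (by norm_num) hn'
        linarith
      have ha := h3 _ he a (Sym2.mem_mk_left _ _)
      have hb := h3 _ he b (Sym2.mem_mk_right _ _)
      have hs := h7 _ _ he
      rcases le_or_gt 4 (edgeDeg S b) with h | h
      · exact key _ _ ha h
      · rw [add_comm]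
        exact key _ _ hb (by omega)
  have h4 := sum_le_sum h2
  rw [← h1, sum_const, nsmul_eq_mul] at h4
  have : (12 * #{v | edgeDeg S v ≠ 0} : ℚ) ≤ 7 * #S := by linarith
  exact_mod_cast this

/-- A set of edges with degree `3` at every vertex contains a cycle with a chord. -/
theorem exists_cycle_with_chord [Finite V] {S : Finset (Sym2 V)} (hdiag : ∀ e ∈ S, ¬e.IsDiag)
    (hne : S.Nonempty) (h3 : ∀ e ∈ S, ∀ v ∈ e, edgeDeg S v = 3) :
    ∃ (g : ℕ → V) (i j : ℕ), 2 ≤ i ∧ i < j ∧ (∀ a ≤ j, ∀ b ≤ j, g a = g b → a = b) ∧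
      (∀ a < j, s(g a, g (a + 1)) ∈ S) ∧ s(g j, g 0) ∈ S ∧ s(g 0, g i) ∈ S := by
  let H : SimpleGraph V := SimpleGraph.fromEdgeSet (S : Set (Sym2 V))
  have hH : ∀ u v, H.Adj u v ↔ s(u, v) ∈ S := by
    intro u v
    rw [SimpleGraph.fromEdgeSet_adj]
    exact ⟨fun h ↦ h.1, fun h ↦ ⟨h, fun h' ↦ hdiag _ h h'⟩⟩
  obtain ⟨e₀, he₀⟩ := hne
  obtain ⟨a, b, hab⟩ : ∃ a b, H.Adj a b := by
    induction e₀ with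
    | _ a b => exact ⟨a, b, (hH a b).2 he₀⟩
  have : Nonempty V := ⟨a⟩
  obtain ⟨x, y, p, hp, hmax⟩ := SimpleGraph.Walk.exists_isPath_forall_isPath_length_le_length H
  have hlen := hmax a b hab.toWalk (by simp [SimpleGraph.Walk.isPath_def, hab.ne])
  have hnil : ¬p.Nil := by
    intro hn
    rw [← SimpleGraph.Walk.length_eq_zero_iff] at hn
    simp [hn] at hlen
  have hx : edgeDeg S x = 3 :=
    h3 _ ((hH _ _).1 (p.adj_snd hnil)) x (Sym2.mem_mk_left _ _)
  -- Positions on a longest path of the neighbours of its start `x`. By maximality all three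
  -- neighbours are on the path; the farthest one closes the cycle.
  let I : Finset ℕ := {t ∈ range (p.length + 1) | H.Adj x (p.getVert t)}
  have hI : 3 ≤ #I := by
    rw [← hx]
    refine (card_le_card (t := I.image fun t ↦ s(x, p.getVert t)) fun e he ↦ ?_).trans
      card_image_le
    obtain ⟨heS, hxe⟩ := mem_filter.1 he
    obtain ⟨w, rfl⟩ := Sym2.mem_iff_exists.1 hxe
    have hxw := (hH x w).2 heS
    have hw : w ∈ p.support := by
      by_contra hw
      have := hmax _ _ (p.cons hxw.symm) (hp.cons hw)
      rw [SimpleGraph.Walk.length_cons] at this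
      omega
    obtain ⟨t, rfl, ht⟩ := SimpleGraph.Walk.mem_support_iff_exists_getVert.1 hw
    exact mem_image.2 ⟨t, mem_filter.2 ⟨mem_range.2 (by omega), hxw⟩, rfl⟩
  have hIne : I.Nonempty := card_pos.1 (by omega)
  let j := I.max' hIne
  have hj : j ∈ I := I.max'_mem hIne
  -- Of at least three positions, one is neither the first step of the path nor the closing one: it
  -- gives the chord.
  obtain ⟨i, hi, hij⟩ : ∃ i ∈ I, i ∉ ({1, j} : Finset ℕ) := by
    by_contra! hcon
    have := (card_le_card hcon).trans card_le_two
    omega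
  simp only [mem_insert, mem_singleton, not_or] at hij
  have hij' : i < j := lt_of_le_of_ne (I.le_max' i hi) hij.2
  obtain ⟨hjlen, hjadj⟩ := mem_filter.1 hj
  obtain ⟨_, hiadj⟩ := mem_filter.1 hi
  rw [mem_range] at hjlen
  have hi0 : i ≠ 0 := by
    rintro rfl
    exact hiadj.ne p.getVert_zero.symm
  refine ⟨p.getVert, i, j, by omega, hij', ?_, ?_, ?_, ?_⟩
  · exact fun a ha b hb h ↦ hp.getVert_injOn (show a ≤ p.length by omega)
      (show b ≤ p.length by omega) h
  · exact fun a ha ↦ (hH _ _).1 (p.adj_getVert_succ (by omega))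
  · rw [p.getVert_zero]
    exact (hH _ _).1 hjadj.symm
  · rw [p.getVert_zero]
    exact (hH _ _).1 hiadj

/-- Edge sets that are regular of degree `3` are reducible for lists of size `4`. -/
theorem IsEdgeSystem.exists_coloring_of_cubic (hC : IsEdgeSystem C) [Finite V]
    {L : Sym2 V → Finset A} {S : Finset (Sym2 V)} (hL : ∀ e ∈ S, #(L e) = 4)
    (hdiag : ∀ e ∈ S, ¬e.IsDiag) (hne : S.Nonempty) (h3 : ∀ e ∈ S, ∀ v ∈ e, edgeDeg S v = 3)
    (ih : ∀ T ⊂ S, ∃ c, C.IsColoring L T c) : ∃ c, C.IsColoring L S c := by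
  obtain ⟨g, i, j, hi, hij, hinj, hpath, hlast, hchord⟩ := exists_cycle_with_chord hdiag hne h3
  have hg : ∀ a b c d, a ≤ j → b ≤ j → c ≤ j → d ≤ j → s(g a, g b) = s(g c, g d) →
      a = c ∧ b = d ∨ a = d ∧ b = c := by
    intro a b c d ha hb hc hd h
    rcases Sym2.eq_iff.1 h with h | h
    · exact Or.inl ⟨hinj _ ha _ hc h.1, hinj _ hb _ hd h.2⟩
    · exact Or.inr ⟨hinj _ ha _ hd h.1, hinj _ hb _ hc h.2⟩
  -- The cycle's edges in order. The last one, `e j`, is the closing edge at `g 0`, an end of the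
  -- chord.
  let e : ℕ → Sym2 V := fun t ↦ if t < j then s(g t, g (t + 1)) else s(g j, g 0)
  have he : ∀ t < j, e t = s(g t, g (t + 1)) := fun t ht ↦ if_pos ht
  have hej : e j = s(g j, g 0) := if_neg (lt_irrefl j)
  have heS : ∀ t ≤ j, e t ∈ S := by
    intro t ht
    rcases ht.lt_or_eq with h | rfl
    · rw [he t h]
      exact hpath t h
    · rwa [hej]
  have heinj : ∀ a ≤ j, ∀ b ≤ j, e a = e b → a = b := by
    intro a ha b hb h
    rcases ha.lt_or_eq with ha | rfl <;> rcases hb.lt_or_eq with hb | rfl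
    · rw [he a ha, he b hb] at h
      have := hg _ _ _ _ (by omega) (by omega) (by omega) (by omega) h
      omega
    · rw [he a ha, hej] at h
      have := hg _ _ _ _ (by omega) (by omega) (by omega) (by omega) h
      omega
    · rw [hej, he b hb] at h
      have := hg _ _ _ _ (by omega) (by omega) (by omega) (by omega) h
      omega
    · rfl
  let x : Sym2 V := s(g 0, g i)
  have hex : ∀ t ≤ j, e t ≠ x := by
    intro t ht h
    rcases ht.lt_or_eq with ht | rfl
    · rw [he t ht] at h
      have := hg _ _ _ _ (by omega) (by omega) (by omega) (by omega) h
      omega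
    · rw [hej] at h
      have := hg _ _ _ _ (by omega) (by omega) (by omega) (by omega) h
      omega
  have hnbr : ∀ a b, a ≤ j → b ≤ j → a ≠ b → (∃ v, v ∈ e a ∧ v ∈ e b) → C.Nbr (e a) (e b) :=
    fun a b ha hb hab h ↦ (hC _ _).2 ⟨fun h' ↦ hab (heinj a ha b hb h'), h⟩
  let K : Finset (Sym2 V) := (range (j + 1)).image e
  have hK : ∀ t ≤ j, e t ∈ K := fun t ht ↦ mem_image_of_mem _ (mem_range.2 (by omega))
  have hKS : K ⊆ S := by
    refine image_subset_iff.2 fun t ht ↦ heS t ?_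
    rw [mem_range] at ht
    omega
  have hxK : x ∉ K := by
    intro h
    obtain ⟨t, ht, h⟩ := mem_image.1 h
    rw [mem_range] at ht
    exact hex t (by omega) h
  let T := S \ insert x K
  obtain ⟨c, hc⟩ := ih T ((ssubset_iff_of_subset sdiff_subset).2
    ⟨x, hchord, fun h ↦ (mem_sdiff.1 h).2 (mem_insert_self _ _)⟩)
  have hdeg : ∀ z ∈ S, #{y ∈ S | C.Nbr z y} ≤ 4 := by
    intro z hz
    induction z with
    | _ u v =>
      have h := hC.card_nbr_add_two_le hz
      rw [h3 _ hz u (Sym2.mem_mk_left _ _), h3 _ hz v (Sym2.mem_mk_right _ _)] at h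
      omega
  -- Every edge has at most 4 neighbours in `S`, so each known uncoloured neighbour lowers the
  -- number of coloured ones.
  have hT : ∀ z ∈ S, ∀ Q ⊆ insert x K, (∀ y ∈ Q, C.Nbr z y) → #{y ∈ T | C.Nbr z y} + #Q ≤ 4 := by
    intro z hz Q hQ hQz
    rw [← card_union_of_disjoint]
    · refine (card_le_card (union_subset (filter_subset_filter _ sdiff_subset) fun y hy ↦ ?_)).trans
        (hdeg z hz)
      exact mem_filter.2 ⟨insert_subset hchord hKS (hQ hy), hQz y hy⟩
    · exact disjoint_left.2 fun y hy hyQ ↦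
        (mem_sdiff.1 (mem_filter.1 hy).1).2 (hQ hyQ)
  -- Why 3: `e j` has the uncoloured neighbours `x`, `e 0` and `e (j - 1)`, so at least 3 colours
  -- remain, and only two of these neighbours lie on the path. The chord `x` has four uncoloured
  -- neighbours `e 0`, `e j`, `e (i - 1)`, `e i`, so it keeps all 4 colours.
  refine hc.exists_extend (n := 3) (m := j) (e := e) (x := x) (fun z hz ↦ ?_) ?_ ?_ ?_ heinj
    ?_ ?_ ?_ ?_
  · rw [hL z hz]
    exact hdeg z hz
  · rw [insert_union, ← union_insert]
    exact (sdiff_union_of_subset (insert_subset hchord hKS)).symm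
  · exact fun h ↦ (mem_sdiff.1 h).2 (mem_insert_self _ _)
  · intro t ht h
    rcases mem_insert.1 h with h | h
    · exact hex t ht h
    · exact (mem_sdiff.1 h).2 (mem_insert_of_mem (hK t ht))
  · intro t ht
    refine hnbr t (t + 1) (by omega) (by omega) (by omega) ⟨g (t + 1), ?_, ?_⟩
    · rw [he t ht]
      exact Sym2.mem_mk_right _ _
    · rcases (show t + 1 ≤ j by omega).lt_or_eq with h | h
      · rw [he _ h]
        exact Sym2.mem_mk_left _ _
      · rw [h, hej]
        exact Sym2.mem_mk_left _ _
  · refine (card_le_card (t := {e 0, e (j - 1)}) fun y hy ↦ ?_).trans_lt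
      (card_le_two.trans_lt (by norm_num))
    obtain ⟨hy, hN⟩ := mem_filter.1 hy
    obtain ⟨t, ht, rfl⟩ := mem_image.1 hy
    rw [mem_range] at ht
    obtain ⟨_, v, hv, hvt⟩ := (hC _ _).1 hN
    rw [hej] at hv
    rw [he t ht] at hvt
    have : t = 0 ∨ t = j - 1 := by
      rcases Sym2.mem_iff.1 hv with rfl | rfl <;> rcases Sym2.mem_iff.1 hvt with h | h
      all_goals
        have := hinj _ (by omega) _ (by omega) h
        omega
    rcases this with rfl | rfl
    · exact mem_insert_self _ _
    · exact mem_insert_of_mem (mem_singleton_self _)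
  · rw [hL _ (heS j le_rfl)]
    have h1 := hT (e j) (heS j le_rfl) {x, e 0, e (j - 1)} ?_ ?_
    · rwa [card_eq_three.2 ⟨x, e 0, e (j - 1), (hex 0 (by omega)).symm,
        (hex (j - 1) (by omega)).symm, fun h ↦ by
          have := heinj 0 (by omega) (j - 1) (by omega) h
          omega, rfl⟩, add_comm] at h1
    · simp only [insert_subset_iff, singleton_subset_iff]
      exact ⟨mem_insert_self _ _, mem_insert_of_mem (hK 0 (by omega)),
        mem_insert_of_mem (hK _ (by omega))⟩
    · intro y hy
      simp only [mem_insert, mem_singleton] at hy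
      rcases hy with rfl | rfl | rfl
      · exact (hC _ _).2 ⟨hex j le_rfl, g 0, by simp [hej], by simp [x]⟩
      · exact hnbr _ _ le_rfl (by omega) (by omega)
          ⟨g 0, by simp [hej], by simp [he 0 (by omega)]⟩
      · refine hnbr _ _ le_rfl (by omega) (by omega) ⟨g j, by simp [hej], ?_⟩
        rw [he _ (by omega), Nat.sub_add_cancel (by omega)]
        exact Sym2.mem_mk_right _ _
  · rw [hL _ hchord]
    have h1 := hT x hchord (({0, j, i - 1, i} : Finset ℕ).image e) ?_ ?_
    · rw [card_image_of_injOn] at h1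
      · have : #({0, j, i - 1, i} : Finset ℕ) = 4 := by
          rw [card_insert_of_notMem, card_insert_of_notMem, card_insert_of_notMem, card_singleton]
          all_goals
            simp only [mem_insert, mem_singleton]
            omega
        omega
      · intro a ha b hb h
        simp only [coe_insert, coe_singleton, Set.mem_insert_iff, Set.mem_singleton_iff] at ha hb
        exact heinj a (by omega) b (by omega) h
    · refine image_subset_iff.2 fun t ht ↦ mem_insert_of_mem (hK t ?_)
      simp only [mem_insert, mem_singleton] at ht
      omega
    · intro y hy
      obtain ⟨t, ht, rfl⟩ := mem_image.1 hy
      simp only [mem_insert, mem_singleton] at ht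
      rcases ht with rfl | rfl | rfl | rfl
      · exact (hC _ _).2 ⟨(hex _ (by omega)).symm, g 0, by simp [x], by simp [he 0 (by omega)]⟩
      · exact (hC _ _).2 ⟨(hex _ le_rfl).symm, g 0, by simp [x], by simp [hej]⟩
      · refine (hC _ _).2 ⟨(hex _ (by omega)).symm, g i, by simp [x], ?_⟩
        rw [he _ (by omega), Nat.sub_add_cancel (by omega)]
        exact Sym2.mem_mk_right _ _
      · exact (hC _ _).2 ⟨(hex _ (by omega)).symm, g t, by simp [x], by simp [he t (by omega)]⟩

end

end EdgeColoring

/-! ### The induction over edge sets and the passage to group colourings -/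

namespace EdgeColoring

open Finset

open scoped Classical in
/-- Edges of a graph of girth at least `5` with a model in the grid can be coloured from lists that
are larger than all degrees. -/
theorem IsEdgeSystem.exists_coloring {V : Type u} {A : Type w} [Nonempty A] [Fintype V]
    {C : ConflictSystem (Sym2 V) A} (hC : IsEdgeSystem C) {G : SimpleGraph V} (M : GridModel G)
    (hgirth : 5 ≤ G.egirth) {L : Sym2 V → Finset A} {D : ℕ} (hL : ∀ e ∈ G.edgeSet, #(L e) = D + 1)
    (S : Finset (Sym2 V)) (hS : (S : Set (Sym2 V)) ⊆ G.edgeSet) (hD : ∀ v, edgeDeg S v ≤ D) :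
    ∃ c, C.IsColoring L S c := by
  induction S using Finset.strongInduction with
  | H S ih =>
    have ih' : ∀ T ⊂ S, ∃ c, C.IsColoring L T c := fun T hT ↦
      ih T hT ((coe_subset.2 hT.subset).trans hS) fun v ↦
        (card_le_card (filter_subset_filter _ hT.subset)).trans (hD v)
    have hdiag : ∀ e ∈ S, ¬e.IsDiag := fun e he ↦ G.not_isDiag_of_mem_edgeSet (hS he)
    -- Such an edge has at most `D` neighbours against `D + 1` colours, so it can be coloured last.
    by_cases hred : ∃ u v, s(u, v) ∈ S ∧ edgeDeg S u + edgeDeg S v ≤ D + 2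
    · obtain ⟨u, v, he, hle⟩ := hred
      obtain ⟨c, hc⟩ := ih' _ (erase_ssubset he)
      have h1 := hC.card_nbr_add_two_le he
      have h2 : #{e ∈ S.erase s(u, v) | C.Nbr s(u, v) e} ≤ #{e ∈ S | C.Nbr s(u, v) e} :=
        card_le_card (filter_subset_filter _ (erase_subset _ _))
      obtain ⟨a, -, ha⟩ := hc.exists_insert_update (notMem_erase s(u, v) S) Subset.rfl
        (by rw [hL _ (hS he)]; omega)
      rw [insert_erase he] at ha
      exact ⟨_, ha⟩
    push Not at hred
    rcases S.eq_empty_or_nonempty with rfl | hne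
    · exact ⟨fun _ ↦ Classical.arbitrary A, by simp, by simp⟩
    have h3 : ∀ e ∈ S, ∀ v ∈ e, 3 ≤ edgeDeg S v := by
      intro e he v hv
      obtain ⟨w, rfl⟩ := Sym2.mem_iff_exists.1 hv
      have := hred v w he
      have := hD w
      omega
    have hD3 : 3 ≤ D := by
      obtain ⟨e, he⟩ := hne
      induction e with
      | _ u v => exact (h3 _ he u (Sym2.mem_mk_left _ _)).trans (hD u)
    rcases hD3.eq_or_lt with rfl | hD4
    · exact hC.exists_coloring_of_cubic (fun e he ↦ hL e (hS he)) hdiag hne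
        (fun e he v hv ↦ le_antisymm (hD v) (h3 e he v hv)) ih'
    -- With `D ≥ 4` degree sums are at least 7. The discharging bound and the planar bound for the
    -- graph of `S` are incompatible.
    · exfalso
      have h12 := twelve_mul_card_le hdiag h3 fun u v he ↦ by
        have := hred u v he
        omega
      let H : SimpleGraph V := SimpleGraph.fromEdgeSet (S : Set (Sym2 V))
      have hHG : H ≤ G := by
        intro u v h
        exact hS ((SimpleGraph.fromEdgeSet_adj _).1 h).1
      have hHS : ∀ i : Fintype H.edgeSet, @SimpleGraph.edgeFinset _ H i = S := by
        intro _
        ext e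
        rw [SimpleGraph.mem_edgeFinset, SimpleGraph.edgeSet_fromEdgeSet, Set.mem_sdiff, mem_coe]
        exact ⟨fun h ↦ h.1, fun h ↦ ⟨h, hdiag e h⟩⟩
      have h5 := (M.restrict hHG).card_edgeFinset_le (n := 5)
        (hgirth.trans (SimpleGraph.egirth_anti hHG))
      have hV : ∀ i : DecidablePred fun v ↦ ∃ w, H.Adj v w,
          #(@Finset.filter V (fun v ↦ ∃ w, H.Adj v w) i univ) ≤ #{v | edgeDeg S v ≠ 0} := by
        intro i
        refine card_le_card fun v hv ↦ ?_
        obtain ⟨w, hw⟩ := (mem_filter.1 hv).2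
        have := h3 _ ((SimpleGraph.fromEdgeSet_adj _).1 hw).1 v (Sym2.mem_mk_left _ _)
        exact mem_filter.2 ⟨mem_univ _, by omega⟩
      rw [hHS] at h5
      have := h5.trans (Nat.add_le_add_left (Nat.mul_le_mul_left 5 (hV _)) _)
      have := card_pos.2 hne
      omega

open SimpleGraph in
/-- The conflicts between edges that are given by an orientation of the line graph. -/
def orientationSystem {V : Type u} {A : Type w} [AddCommGroup A] {G : SimpleGraph V}
    (D : G.lineGraph.EdgeOrientation) (f : G.lineGraph.edgeSet → A) :
    ConflictSystem (Sym2 V) A where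
  Nbr e e' := e ≠ e' ∧ ∃ v, v ∈ e ∧ v ∈ e'
  nbr_ne h := h.1
  nbr_symm h := ⟨h.1.symm, h.2.imp fun _ h ↦ h.symm⟩
  Bad e e' a b := ∃ (he : e ∈ G.edgeSet) (he' : e' ∈ G.edgeSet),
    (∃ h : D.Arc ⟨e, he⟩ ⟨e', he'⟩, a - b = f ⟨_, G.lineGraph.mem_edgeSet.2 (D.adj h)⟩) ∨
      ∃ h : D.Arc ⟨e', he'⟩ ⟨e, he⟩, b - a = f ⟨_, G.lineGraph.mem_edgeSet.2 (D.adj h)⟩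
  bad_nbr := by
    rintro e e' a b ⟨he, he', h⟩
    have h1 : G.lineGraph.Adj ⟨e, he⟩ ⟨e', he'⟩ :=
      (D.adj_iff _ _).2 (h.imp (fun h ↦ h.1) fun h ↦ h.1)
    rw [lineGraph_adj_iff_exists] at h1
    exact ⟨fun h ↦ h1.1 (Subtype.ext h), h1.2⟩
  bad_symm := fun ⟨he, he', h⟩ ↦ ⟨he', he, h.symm⟩
  -- With `a` and `f` given, the difference determines the other colour; asymmetry rules out two
  -- opposite arcs.
  bad_unique := by
    rintro e e' a b b' ⟨he, he', ⟨h, hab⟩ | ⟨h, hab⟩⟩ ⟨_, _, ⟨h', hab'⟩ | ⟨h', hab'⟩⟩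
    · exact sub_right_injective (hab.trans hab'.symm)
    · exact absurd h' (D.asymm _ _ h)
    · exact absurd h (D.asymm _ _ h')
    · exact sub_left_injective (hab.trans hab'.symm)

end EdgeColoring

theorem mainTheorem3 {V : Type u} [Fintype V] (G : SimpleGraph V) [DecidableRel G.Adj]
    (hplanar : G.IsPlanar) (hgirth : 5 ≤ G.egirth) :
    SimpleGraph.IsGroupEdgeChoosable.{u, w} G (G.maxDegree + 1) := by
  classical
  intro D A _ _ L hL f
  obtain ⟨P⟩ := hplanar
  obtain ⟨M⟩ := P.nonempty_gridModel
  -- Pairs that are not edges get the empty list, which is harmless since only edges of `G` are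
  -- coloured.
  let L' : Sym2 V → Finset A := fun e ↦ if h : e ∈ G.edgeSet then L ⟨e, h⟩ else ∅
  have hL' : ∀ e (h : e ∈ G.edgeSet), L' e = L ⟨e, h⟩ := fun e h ↦ dif_pos h
  have hC : EdgeColoring.IsEdgeSystem (EdgeColoring.orientationSystem D f) := fun _ _ ↦ Iff.rfl
  obtain ⟨c, hcL, hc⟩ := hC.exists_coloring M hgirth (L := L') (D := G.maxDegree)
    (fun e he ↦ by rw [hL' e he, hL]) G.edgeFinset (by simp) fun v ↦ by
      refine le_trans (le_of_eq ?_) (G.degree_le_maxDegree v)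
      rw [← G.card_incidenceFinset_eq_degree, EdgeColoring.edgeDeg]
      congr 1
      ext e
      simp [SimpleGraph.incidenceSet]
  refine ⟨fun e ↦ c e, fun x y h hxy ↦ ?_, fun e ↦ ?_⟩
  · exact hc x (SimpleGraph.mem_edgeFinset.2 x.2) y (SimpleGraph.mem_edgeFinset.2 y.2)
      ⟨x.2, y.2, Or.inl ⟨h, hxy⟩⟩
  · rw [← hL' e e.2]
    exact hcL e (SimpleGraph.mem_edgeFinset.2 e.2)
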